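/- \textbf{Setting.} Fix $N,d\in\mathbb N$ with $d\ge 2$ and real numbers $\alpha,\beta>0$. An $N$-graph $G$ is the quotient of $\bigcup_{i=1}^N [0,1]\times\{i\}$ by an equivalence relation $\sim$ on the set of endpoints $\{0,1\}\times\{1,\dots,N\}$; its vertices are the classes of endpoints, and a subgraph is given by a subset of the edges. To each end $(z,i)\in\{0,1\}\times\{1,\dots,N\}$ a direction $d^{z,i}\in\mathbb S^{d-1}$ is assigned. A network $(G,\Gamma)$ is a continuous map $\Gamma:G\to\mathbb R^d$ whose curves $\gamma^i=\Gamma|_{E_i}:[0,1]\to\mathbb R^d$ are each either constant (\emph{singular}) or an immersion of class $H^2$ (\emph{regular}); networks on a subgraph are defined in the same way. $\mathrm{Sing}$ denotes the subgraph of the singular edges. The energy is $$\widetilde{\mathcal E}(\mathcal N)=\sum_{i=1}^N\Big(\alpha\int_{\gamma^i}|\vec k^i|^2\,ds+\beta\,\ell(\gamma^i)\Big),$$ where $\vec k^i$ is the curvature vector (zero on singular curves) and $\ell$ is the length. \emph{Angle condition.} A network $(H,\Sigma)$ on a subgraph $H\subseteq G$ satisfies the angle condition with tangents $(\tau^{z,i})$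 if $\tau^{z,i}=(-1)^z\dot\sigma^i(z)/|\dot\sigma^i(z)|$ for every regular curve $\sigma^i$ of it; $\tau^{0,i}=-\tau^{1,i}$ are unit vectors (virtual tangents) for every singular one; and for every vertex $p$ there is a rotation $R_p\in SO(d)$ with $\tau^{z,i}=R_p(d^{z,i})$ for all ends $(z,i)$ of edges of $H$ that meet at $p$. \emph{Stratified-straight.} A subgraph $H$ is stratified-straight with tangents $(\tau^{z,i})$ if there are finitely many subgraphs $\emptyset=H_q\subseteq\dots\subseteq H_1\subseteq H_0=H$ and networks $(H_j,\Sigma_j)$, $0\le j<q$, each of which satisfies the angle condition with these same tangents and has only straight segments as regular curves, and such that $H_{j+1}=\mathrm{Sing}(H_j,\Sigma_j)$. $\mathcal C_{\rm Reg}$ is the class of networks on $G$ without singular curves that satisfy the angle condition. $\mathcal C_{\rm Deg}$ (degenerate networks) is the class of networks on $G$ that satisfy the angle condition with some tangents $(\tau^{z,i})$ and whose singular part is stratified-straight with the same tangents. \textbf{Proposition (Compactness).} Let $\mathcal N_n=(G,\Gamma_n)$ be a sequence in $\mathcal C_{\rm Deg}$ with $\limsup_n\widetilde{\mathcal E}(\mathcal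 N_n)\le C<+\infty$. Then there is a subsequence which, after a translation of each connected component of $G$ (a single translation of the whole network if $G$ is connected) and after orientation-preserving $H^2$ reparametrizations of the edges, converges on every edge weakly in $H^2(0,1)$ and strongly in $C^{1,\theta}([0,1])$ for every $\theta\in(0,\tfrac12)$ to the curves of a network $\mathcal N_\infty=(G,\Gamma_\infty)\in\mathcal C_{\rm Deg}$. In particular the same holds, with $\mathcal N_\infty\in\mathcal C_{\rm Deg}$, if all $\mathcal N_n$ are in $\mathcal C_{\rm Reg}$. -/

import Mathlib

open MeasureTheory Set Filter Topology

noncomputable section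

namespace ElasticNetwork

/-! ### Curves of class `H²` on `[0,1]` -/

section Curves

variable {F : Type*} [NormedAddCommGroup F] [NormedSpace ℝ F]

/-- The velocity `γ̇` of a curve on `[0,1]`. All notions below depend only on the values of a
curve on `[0,1]`, although curves are written as functions on `ℝ`. -/
def vel (γ : ℝ → F) : ℝ → F := derivWithin γ (Icc 0 1)

/-- The acceleration `γ̈` of a curve on `[0,1]`. For a curve of class `H²` it exists almost
everywhere and is the weak second derivative. -/
def acc (γ : ℝ → F) : ℝ → F := derivWithin (vel γ) (Icc 0 1)

/-- The curve `γ : [0,1] → F` is of class `H² = W^{2,2}`: it is differentiable, its derivative is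
absolutely continuous (it is the integral of its a.e. derivative), and the second derivative is
in `L²`. -/
def IsH2 (γ : ℝ → F) : Prop :=
  DifferentiableOn ℝ γ (Icc 0 1) ∧
  MemLp (acc γ) 2 (volume.restrict (Icc 0 1)) ∧
  ∀ t ∈ Icc (0 : ℝ) 1, vel γ t = vel γ 0 + ∫ s in (0 : ℝ)..t, acc γ s

/-- A singular curve: a constant map on `[0,1]`. -/
def IsSingular (γ : ℝ → F) : Prop := ∀ t ∈ Icc (0 : ℝ) 1, γ t = γ 0

/-- A regular curve: an immersion of class `H²`. -/
def IsRegular (γ : ℝ → F) : Prop := IsH2 γ ∧ ∀ t ∈ Icc (0 : ℝ) 1, vel γ t ≠ 0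

/-- The image of `γ` is the straight segment between its endpoints. -/
def IsSegment (γ : ℝ → F) : Prop := γ '' Icc 0 1 = segment ℝ (γ 0) (γ 1)

/-- `γ'` is a reparametrization of `γ` on `[0,1]`, by an orientation preserving diffeomorphism of
`[0,1]` of class `H²`. -/
def IsReparam (γ' γ : ℝ → F) : Prop :=
  ∃ φ : ℝ → ℝ, IsH2 φ ∧ φ 0 = 0 ∧ φ 1 = 1 ∧ (∀ t ∈ Icc (0 : ℝ) 1, 0 < vel φ t) ∧
    ∀ t ∈ Icc (0 : ℝ) 1, γ' t = γ (φ t)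

/-- The length `ℓ(γ)`. -/
def curveLength (γ : ℝ → F) : ℝ := ∫ t in (0 : ℝ)..1, ‖vel γ t‖

/-- The outer tangent `τ^z = (-1)^z γ̇(z) / |γ̇(z)|` of a regular curve at its endpoint
`γ(z)`, `z ∈ {0,1}`. -/
def outerTangent (γ : ℝ → F) (z : Fin 2) : F :=
  (-1 : ℝ) ^ (z : ℕ) • (‖vel γ ((z : ℕ) : ℝ)‖⁻¹ • vel γ ((z : ℕ) : ℝ))

/-- The `C^{1,θ}([0,1])` norm, with values in `[0,∞]`. -/
def c1HolderNorm (θ : ℝ) (f : ℝ → F) : ENNReal :=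
  (⨆ t ∈ Icc (0 : ℝ) 1, ‖f t‖ₑ) + (⨆ t ∈ Icc (0 : ℝ) 1, ‖vel f t‖ₑ) +
    ⨆ s ∈ Icc (0 : ℝ) 1, ⨆ t ∈ Icc (0 : ℝ) 1, ⨆ (_ : s ≠ t),
      ‖vel f s - vel f t‖ₑ / ENNReal.ofReal (|s - t| ^ θ)

/-- Strong convergence in `C^{1,θ}([0,1])`. -/
def TendstoC1Holder (θ : ℝ) (f : ℕ → ℝ → F) (g : ℝ → F) : Prop :=
  Tendsto (fun n => c1HolderNorm θ (fun t => f n t - g t)) atTop (𝓝 0)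

end Curves

/-- The Euclidean space `ℝ^d`. -/
abbrev Eucl (d : ℕ) : Type := EuclideanSpace ℝ (Fin d)

/-- The scalar product of `H²((0,1); ℝ^d)`. -/
def h2Inner {d : ℕ} (f g : ℝ → Eucl d) : ℝ :=
  ∫ t in (0 : ℝ)..1, (inner ℝ (f t) (g t) + inner ℝ (vel f t) (vel g t) +
    inner ℝ (acc f t) (acc g t))

/-- Weak convergence in the Hilbert space `H²((0,1); ℝ^d)`. -/
def TendstoWeakH2 {d : ℕ} (f : ℕ → ℝ → Eucl d) (g : ℝ → Eucl d) : Prop :=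
  (∀ n, IsH2 (f n)) ∧ IsH2 g ∧
  ∀ φ : ℝ → Eucl d, IsH2 φ → Tendsto (fun n => h2Inner (f n) φ) atTop (𝓝 (h2Inner g φ))

/-- The curvature vector; it vanishes for singular curves, where `γ̇ = γ̈ = 0`. -/
def curvature {d : ℕ} (γ : ℝ → Eucl d) (t : ℝ) : Eucl d :=
  (‖vel γ t‖ ^ 2)⁻¹ • acc γ t - (inner ℝ (acc γ t) (vel γ t) / ‖vel γ t‖ ^ 4) • vel γ t

/-! ### Graphs and networks -/

/-- The set `V = {0,1} × {1,…,N}` of the endpoints of the `N` intervals `I_i = [0,1] × {i}`. -/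
abbrev Ends (N : ℕ) : Type := Fin 2 × Fin N

/-- An `N`-graph: an equivalence relation that identifies points of `V`. The vertices are the
elements of `Quotient G`, and `Quotient.mk G (z, i)` is the vertex at the end `z` of edge `i`.
A subgraph is given by its set of edges `H : Set (Fin N)`. -/
abbrev NGraph (N : ℕ) : Type := Setoid (Ends N)

/-- The connected components of an `N`-graph: the classes of edges under the equivalence relation
generated by having a common vertex. -/
def NGraph.Component {N : ℕ} (G : NGraph N) : Type :=
  Quot (fun i j : Fin N => ∃ z w : Fin 2, G.r (z, i) (w, j))

/-- The component of an edge. -/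
def NGraph.component {N : ℕ} (G : NGraph N) (i : Fin N) : G.Component := Quot.mk _ i

variable {N d : ℕ}

/-- The pair `(H, Γ)` is a network, `H` being a subgraph of `G`. The map `Γ : H → ℝ^d` is given by
the curves `Γ i` on the edges of `H`. It is a well-defined continuous map on the quotient space `H`
iff the curves are continuous (regular and singular curves are) and their values at
identified endpoints agree. -/
def IsNetwork (G : NGraph N) (H : Set (Fin N)) (Γ : Fin N → ℝ → Eucl d) : Prop :=
  (∀ i ∈ H, IsSingular (Γ i) ∨ IsRegular (Γ i)) ∧
  ∀ z w : Fin 2, ∀ i ∈ H, ∀ j ∈ H, G.r (z, i) (w, j) →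
    Γ i ((z : ℕ) : ℝ) = Γ j ((w : ℕ) : ℝ)

/-- The (edges of the) singular part of the network `(H, Γ)`. -/
def Sing (H : Set (Fin N)) (Γ : Fin N → ℝ → Eucl d) : Set (Fin N) :=
  {i ∈ H | IsSingular (Γ i)}

/-- The elastic energy `α ∫ |k|² ds + β L` of a (regular or singular) network. -/
def energy (α β : ℝ) (Γ : Fin N → ℝ → Eucl d) : ℝ :=
  ∑ i, (α * (∫ t in (0 : ℝ)..1, ‖curvature (Γ i) t‖ ^ 2 * ‖vel (Γ i) t‖) +
    β * curveLength (Γ i))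

/-- At each vertex `p` of the subgraph `H`, the vectors `τ^{z,i}` at the ends of edges of `H` which
meet at `p` are the images of the assigned directions `D^{z,i}` under one rotation `R_p`. -/
def IsRotated (G : NGraph N) (D : Ends N → Metric.sphere (0 : Eucl d) 1) (H : Set (Fin N))
    (τ : Ends N → Eucl d) : Prop :=
  ∀ p : Quotient G, ∃ R ∈ Matrix.specialOrthogonalGroup (Fin d) ℝ,
    ∀ z : Fin 2, ∀ i ∈ H, Quotient.mk G (z, i) = p →
      τ (z, i) = Matrix.toEuclideanLin R (D (z, i) : Eucl d)

/-- The network `(H, Γ)` satisfies the angle condition with real or virtual tangents `τ^{z,i}`: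
on regular curves these are the outer tangents, on singular curves they are two opposite unit
vectors. -/
def AngleCondition (G : NGraph N) (D : Ends N → Metric.sphere (0 : Eucl d) 1) (H : Set (Fin N))
    (Γ : Fin N → ℝ → Eucl d) (τ : Ends N → Eucl d) : Prop :=
  (∀ i ∈ H, IsRegular (Γ i) → ∀ z, τ (z, i) = outerTangent (Γ i) z) ∧
  (∀ i ∈ H, IsSingular (Γ i) → (∀ z, ‖τ (z, i)‖ = 1) ∧ τ (0, i) = -τ (1, i)) ∧
  IsRotated G D H τ

/-- The subgraph `H` is stratified-straight with (real or virtual) tangents `τ^{z,i}`: there are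
strata `∅ = H_q ⊂ … ⊂ H_0 = H` and maps `S_j : H_j → ℝ^d` such that each `(H_j, S_j)` is a network
which satisfies the angle condition with these tangents, whose regular curves are
straight segments, and whose singular part is `H_{j+1}`. -/
def StratifiedStraight (G : NGraph N) (D : Ends N → Metric.sphere (0 : Eucl d) 1)
    (τ : Ends N → Eucl d) (H : Set (Fin N)) : Prop :=
  ∃ (q : ℕ) (K : ℕ → Set (Fin N)) (S : ℕ → Fin N → ℝ → Eucl d),
    K 0 = H ∧ K q = ∅ ∧
    ∀ j < q, IsNetwork G (K j) (S j) ∧ AngleCondition G D (K j) (S j) τ ∧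
      (∀ i ∈ K j, IsRegular (S j i) → IsSegment (S j i)) ∧
      K (j + 1) = Sing (K j) (S j)

/-- The class of regular networks on `G` that fulfil the angle condition. -/
def CReg (G : NGraph N) (D : Ends N → Metric.sphere (0 : Eucl d) 1) :
    Set (Fin N → ℝ → Eucl d) :=
  {Γ | IsNetwork G univ Γ ∧ Sing univ Γ = ∅ ∧
    IsRotated G D univ (fun e => outerTangent (Γ e.2) e.1)}

/-- The class of degenerate networks on `G`. -/
def CDeg (G : NGraph N) (D : Ends N → Metric.sphere (0 : Eucl d) 1) :
    Set (Fin N → ℝ → Eucl d) :=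
  {Γ | IsNetwork G univ Γ ∧ ∃ τ : Ends N → Eucl d,
    AngleCondition G D univ Γ τ ∧ StratifiedStraight G D τ (Sing univ Γ)}

/-- The sequence of networks `Γ_n`, up to a translation of each connected component of `G` (a single
translation if `G` is connected) and up to reparametrization of the edges, converges to
`Γ_∞` weakly in `H²` and strongly in `C^{1,θ}` for every `θ ∈ (0, 1/2)`. -/
def ConvergesUpToTranslation (G : NGraph N) (Γ : ℕ → Fin N → ℝ → Eucl d)
    (Γlim : Fin N → ℝ → Eucl d) : Prop :=
  ∃ (v : ℕ → G.Component → Eucl d) (Γ' : ℕ → Fin N → ℝ → Eucl d),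
    (∀ n i, IsReparam (Γ' n i) (Γ n i)) ∧
    ∀ i, TendstoWeakH2 (fun n t => Γ' n i t + v n (G.component i)) (Γlim i) ∧
      ∀ θ ∈ Ioo (0 : ℝ) (1 / 2),
        TendstoC1Holder θ (fun n t => Γ' n i t + v n (G.component i)) (Γlim i)

end ElasticNetwork

end

/-! Constant speed turns the energy into an H² bound: for a curve of length ℓ parametrized with
speed ℓ, ∫|γ̈|² = ℓ³ ∫|k|² ds, and the energy controls both factors
(`IsRegular.exists_constantSpeed`, `energy_bounds`). Once the initial point of one edge in each
component is moved to the origin, all curves are bounded, so weak L² compactness of the second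
derivatives gives weak H² limits, and the uniform 1/2-Hölder bound on velocities upgrades pointwise
convergence to C^{1,θ} (`exists_curveConverges_subseq`). The limit speed is the limit of the
lengths, hence constant along each edge: every limit curve is regular or constant. Real and virtual
tangents are unit vectors, so they also converge along a subsequence, and being rotated directions
is a closed condition because SO(d) is compact.

The hard point is that the singular part of the limit is stratified-straight. A straight stratum is
determined by its lengths l and directions u, subject to one linear condition: l u must be a family
of displacements of a vertex map. `Stratified` records this data and allows an error ε in the
directions. Two facts then suffice.

First, a curve of length ℓ and bending at most K has chord direction within √(ℓK) of its initial
tangent (`IsRegular.almost_straight`). On the edges that collapse in the limit, the network Γ_n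
itself is therefore a first stratum up to an error ε. Its edges of zero length are the singular
edges of Γ_n, whose strata are given.

Second, approximate strata for every ε > 0 yield exact ones (`Stratified.of_forall_pos`). Normalize
the lengths to sum 1 and pass to the limit: displacements form a finite-dimensional, hence closed,
subspace, and the limit lengths are not all zero. The edges where they vanish are fewer and again
approximately stratified, so induction on the number of edges applies. -/

noncomputable section

namespace ElasticNetwork

/-! ### Calculus of curves with second derivative in L² -/

section Calculus

variable {F : Type*} [NormedAddCommGroup F] [NormedSpace ℝ F]

/-- The curve `γ` has derivative `v` on `[0,1]`, and `v` is a primitive of the `L²` function `g`. -/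
structure HasH2 (γ v g : ℝ → F) : Prop where
  deriv : ∀ t ∈ Icc (0 : ℝ) 1, HasDerivWithinAt γ (v t) (Icc 0 1) t
  memLp : MemLp g 2 (volume.restrict (Icc 0 1))
  eq_integral : ∀ t ∈ Icc (0 : ℝ) 1, v t = v 0 + ∫ s in (0 : ℝ)..t, g s

lemma uniqueDiffWithinAt_unit {t : ℝ} (ht : t ∈ Icc (0 : ℝ) 1) :
    UniqueDiffWithinAt ℝ (Icc (0 : ℝ) 1) t :=
  uniqueDiffOn_Icc_zero_one t ht

lemma IsH2.hasDerivWithinAt {γ : ℝ → F} (h : IsH2 γ) {t : ℝ} (ht : t ∈ Icc (0 : ℝ) 1) :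
    HasDerivWithinAt γ (vel γ t) (Icc 0 1) t :=
  (h.1 t ht).hasDerivWithinAt

lemma IsH2.hasH2 {γ : ℝ → F} (h : IsH2 γ) : HasH2 γ (vel γ) (acc γ) :=
  ⟨fun _ ht => h.hasDerivWithinAt ht, h.2.1, h.2.2⟩

lemma intervalIntegrable_of_memLp {E : Type*} [NormedAddCommGroup E] {g : ℝ → E}
    (hg : MemLp g 2 (volume.restrict (Icc 0 1)))
    {s t : ℝ} (hs : s ∈ Icc (0 : ℝ) 1) (ht : t ∈ Icc (0 : ℝ) 1) :
    IntervalIntegrable g volume s t := by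
  have h1 : IntegrableOn g (Icc 0 1) := hg.integrable (by norm_num)
  refine (h1.mono_set ?_).intervalIntegrable
  exact uIcc_subset_Icc hs ht

lemma intervalIntegrable_sq_of_memLp {E : Type*} [NormedAddCommGroup E] {g : ℝ → E}
    (hg : MemLp g 2 (volume.restrict (Icc 0 1)))
    {s t : ℝ} (hs : s ∈ Icc (0 : ℝ) 1) (ht : t ∈ Icc (0 : ℝ) 1) :
    IntervalIntegrable (fun x => ‖g x‖ ^ 2) volume s t := by
  have h1 : IntegrableOn (fun x => ‖g x‖ ^ 2) (Icc 0 1) := by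
    have := hg.norm.integrable_sq
    exact this
  refine (h1.mono_set ?_).intervalIntegrable
  exact uIcc_subset_Icc hs ht

lemma zero_mem_unit : (0 : ℝ) ∈ Icc (0 : ℝ) 1 := ⟨le_rfl, zero_le_one⟩

lemma one_mem_unit : (1 : ℝ) ∈ Icc (0 : ℝ) 1 := ⟨zero_le_one, le_rfl⟩

lemma fin_two_mem_unit (z : Fin 2) : ((z : ℕ) : ℝ) ∈ Icc (0 : ℝ) 1 := by
  fin_cases z <;> simp

/-- Lebesgue differentiation of the primitive. Discarding the null set {0, 1} turns one-sided
derivatives into two-sided ones. -/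
lemma ae_unit_hasDerivAt [CompleteSpace F] {v g : ℝ → F}
    (hg : MemLp g 2 (volume.restrict (Icc 0 1)))
    (hv : ∀ t ∈ Icc (0 : ℝ) 1, v t = v 0 + ∫ s in (0 : ℝ)..t, g s) :
    ∀ᵐ t, t ∈ Icc (0 : ℝ) 1 → t ∈ Ioo (0 : ℝ) 1 ∧ HasDerivAt v (g t) t := by
  have h0 : ∀ᵐ t : ℝ, t ≠ 0 := by simp [ae_iff, measure_singleton]
  have h1 : ∀ᵐ t : ℝ, t ≠ 1 := by simp [ae_iff, measure_singleton]
  filter_upwards [(intervalIntegrable_of_memLp hg zero_mem_unit one_mem_unit).ae_hasDerivAt_integral,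
    h0, h1] with t ht ht0 ht1 htI
  rw [uIcc_of_le zero_le_one] at ht
  have hto : t ∈ Ioo (0 : ℝ) 1 := ⟨lt_of_le_of_ne htI.1 (Ne.symm ht0), lt_of_le_of_ne htI.2 ht1⟩
  refine ⟨hto, ((ht htI 0 zero_mem_unit).const_add (v 0)).congr_of_eventuallyEq ?_⟩
  filter_upwards [Icc_mem_nhds hto.1 hto.2] with s hs using hv s hs

lemma HasH2.vel_eq {γ v g : ℝ → F} (h : HasH2 γ v g) {t : ℝ} (ht : t ∈ Icc (0 : ℝ) 1) :
    vel γ t = v t :=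
  (h.deriv t ht).derivWithin (uniqueDiffWithinAt_unit ht)

lemma HasH2.acc_ae_eq [CompleteSpace F] {γ v g : ℝ → F} (h : HasH2 γ v g) :
    acc γ =ᵐ[volume.restrict (Icc 0 1)] g := by
  rw [EventuallyEq, ae_restrict_iff' measurableSet_Icc]
  filter_upwards [ae_unit_hasDerivAt h.memLp h.eq_integral] with t ht htI
  refine HasDerivWithinAt.derivWithin ?_ (uniqueDiffWithinAt_unit htI)
  exact ((ht htI).2.hasDerivWithinAt).congr (fun s hs => h.vel_eq hs) (h.vel_eq htI)

lemma setIntegral_congr_unit {E : Type*} [NormedAddCommGroup E] [NormedSpace ℝ E] {f g : ℝ → E}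
    (h : f =ᵐ[volume.restrict (Icc 0 1)] g) {s t : ℝ}
    (hs : s ∈ Icc (0 : ℝ) 1) (ht : t ∈ Icc (0 : ℝ) 1) :
    ∫ x in s..t, f x = ∫ x in s..t, g x := by
  refine intervalIntegral.integral_congr_ae ?_
  rw [EventuallyEq, ae_restrict_iff' measurableSet_Icc] at h
  filter_upwards [h] with x hx hxs
  exact hx (uIcc_subset_Icc hs ht (uIoc_subset_uIcc hxs))

/-- Lets class H² be certified by any explicit velocity and L² density, although `acc γ` agrees with
the density only almost everywhere. -/
lemma HasH2.isH2 [CompleteSpace F] {γ v g : ℝ → F} (h : HasH2 γ v g) : IsH2 γ := by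
  refine ⟨fun t ht => (h.deriv t ht).differentiableWithinAt, h.memLp.ae_eq h.acc_ae_eq.symm, ?_⟩
  intro t ht
  rw [h.vel_eq ht, h.vel_eq zero_mem_unit, h.eq_integral t ht,
    setIntegral_congr_unit h.acc_ae_eq zero_mem_unit ht]

/-- Cauchy–Schwarz for the primitive of an `L²` function. -/
lemma norm_integral_sq_le {g : ℝ → F} (hg : MemLp g 2 (volume.restrict (Icc 0 1)))
    {s t : ℝ} (hs : s ∈ Icc (0 : ℝ) 1) (ht : t ∈ Icc (0 : ℝ) 1) :
    ‖∫ x in s..t, g x‖ ^ 2 ≤ |s - t| * ∫ x in (0 : ℝ)..1, ‖g x‖ ^ 2 := by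
  wlog hst : s ≤ t generalizing s t
  · rw [intervalIntegral.integral_symm, norm_neg, abs_sub_comm]
    exact this ht hs (le_of_not_ge hst)
  rcases hst.eq_or_lt with rfl | hlt
  · simp
  have i1 := (intervalIntegrable_of_memLp hg hs ht).norm
  have i2 := intervalIntegrable_sq_of_memLp hg hs ht
  set A := ∫ x in s..t, ‖g x‖ with hA
  set B := ∫ x in s..t, ‖g x‖ ^ 2 with hB
  have hBle : B ≤ ∫ x in (0 : ℝ)..1, ‖g x‖ ^ 2 := by
    refine intervalIntegral.integral_mono_interval hs.1 hst ht.2 ?_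
      (intervalIntegrable_sq_of_memLp hg zero_mem_unit one_mem_unit)
    exact Eventually.of_forall fun x => by positivity
  have hnA : ‖∫ x in s..t, g x‖ ≤ A := intervalIntegral.norm_integral_le_integral_norm hst
  have hA0 : 0 ≤ A := (norm_nonneg _).trans hnA
  -- `c` is the mean of ‖g‖ on [s, t]; expanding ∫ (‖g‖ - c)² ≥ 0 is Cauchy–Schwarz.
  set c := A / (t - s) with hc
  have hpos : 0 < t - s := sub_pos.2 hlt
  have key : 0 ≤ B - 2 * c * A + c ^ 2 * (t - s) := by
    have h0 : 0 ≤ ∫ x in s..t, (‖g x‖ - c) ^ 2 :=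
      intervalIntegral.integral_nonneg hst fun x _ => sq_nonneg _
    have h1 : ∫ x in s..t, (‖g x‖ - c) ^ 2 = B - 2 * c * A + c ^ 2 * (t - s) := by
      have : (fun x => (‖g x‖ - c) ^ 2) = fun x => (‖g x‖ ^ 2 - (2 * c) * ‖g x‖) + c ^ 2 := by
        ext x; ring
      rw [this, intervalIntegral.integral_add (i2.sub (i1.const_mul _)) (by simp),
        intervalIntegral.integral_sub i2 (i1.const_mul _), intervalIntegral.integral_const_mul,
        intervalIntegral.integral_const, smul_eq_mul, mul_comm (t - s)]
    linarith
  have hcA : c * (t - s) = A := by rw [hc]; field_simp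
  have h2 : A ^ 2 ≤ (t - s) * B := by
    have : A ^ 2 = (t - s) * (c * A) := by rw [← hcA]; ring
    nlinarith
  have habs : |s - t| = t - s := by rw [abs_sub_comm, abs_of_pos hpos]
  rw [habs]
  calc ‖∫ x in s..t, g x‖ ^ 2 ≤ A ^ 2 := by gcongr
    _ ≤ (t - s) * B := h2
    _ ≤ _ := by gcongr

lemma HasH2.norm_sub_sq_le {γ v g : ℝ → F} (h : HasH2 γ v g) {s t : ℝ}
    (hs : s ∈ Icc (0 : ℝ) 1) (ht : t ∈ Icc (0 : ℝ) 1) :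
    ‖v s - v t‖ ^ 2 ≤ |s - t| * ∫ x in (0 : ℝ)..1, ‖g x‖ ^ 2 := by
  have : v t - v s = ∫ x in s..t, g x := by
    rw [h.eq_integral t ht, h.eq_integral s hs, add_sub_add_left_eq_sub,
      intervalIntegral.integral_interval_sub_left
        (intervalIntegrable_of_memLp h.memLp zero_mem_unit ht)
        (intervalIntegrable_of_memLp h.memLp zero_mem_unit hs)]
  rw [norm_sub_rev, this]
  exact norm_integral_sq_le h.memLp hs ht

lemma HasH2.continuousOn_deriv {γ v g : ℝ → F} (h : HasH2 γ v g) :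
    ContinuousOn v (Icc 0 1) := by
  have h1 : IntegrableOn g (Icc 0 1) := h.memLp.integrable (by norm_num)
  have h2 := intervalIntegral.continuousOn_primitive_interval (a := 0) (b := 1) (f := g) (μ := volume)
    (by rwa [uIcc_of_le zero_le_one])
  rw [uIcc_of_le zero_le_one] at h2
  exact (continuousOn_const.add h2).congr fun t ht => h.eq_integral t ht

lemma HasH2.continuousOn {γ v g : ℝ → F} (h : HasH2 γ v g) : ContinuousOn γ (Icc 0 1) :=
  fun t ht => (h.deriv t ht).continuousWithinAt

/-- The fundamental theorem of calculus for absolutely continuous vector valued functions. -/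
lemma eq_add_integral_of_absolutelyContinuous [CompleteSpace F] {f g : ℝ → F}
    (hf : AbsolutelyContinuousOnInterval f 0 1) (hg : IntervalIntegrable g volume 0 1)
    (hfg : ∀ᵐ t, t ∈ Icc (0 : ℝ) 1 → HasDerivAt f (g t) t) {t : ℝ} (ht : t ∈ Icc (0 : ℝ) 1) :
    f t = f 0 + ∫ s in (0 : ℝ)..t, g s := by
  have hI : uIcc (0 : ℝ) 1 = Icc 0 1 := uIcc_of_le zero_le_one
  -- Increments of the vector-valued primitive are dominated by those of the real primitive of ‖g‖.
  have hP : AbsolutelyContinuousOnInterval (fun t => ∫ s in (0 : ℝ)..t, g s) 0 1 := by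
    have hn := hg.norm.absolutelyContinuousOnInterval_intervalIntegral (c := 0) (by simp)
    rw [absolutelyContinuousOnInterval_iff] at hn ⊢
    intro ε hε
    obtain ⟨δ, hδ, h⟩ := hn ε hε
    refine ⟨δ, hδ, fun E hE hsum => (Finset.sum_le_sum fun i hi => ?_).trans_lt (h E hE hsum)⟩
    have h1 := (hE.1 i hi).1
    have h2 := (hE.1 i hi).2
    have hsub : ∀ {x}, x ∈ uIcc (0 : ℝ) 1 → IntervalIntegrable g volume 0 x := fun hx =>
      hg.mono_set (uIcc_subset_uIcc (by simp) hx)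
    rw [dist_eq_norm, Real.dist_eq, intervalIntegral.integral_interval_sub_left (hsub h1) (hsub h2),
      intervalIntegral.integral_interval_sub_left (hsub h1).norm (hsub h2).norm]
    exact intervalIntegral.norm_integral_le_abs_integral_norm
  -- The difference of `f` and the primitive is absolutely continuous with derivative zero a.e.,
  -- hence constant.
  have hd : ∀ᵐ t, t ∈ uIcc (0 : ℝ) 1 →
      HasDerivAt (f - fun t => ∫ s in (0 : ℝ)..t, g s) 0 t := by
    filter_upwards [hfg, hg.ae_hasDerivAt_integral] with x hx1 hx2 hx
    have := (hx1 (hI ▸ hx)).sub (hx2 hx 0 (by simp))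
    rwa [sub_self] at this
  obtain ⟨c, hc⟩ := (hf.sub hP).const_of_ae_hasDerivAt_zero hd
  have h0 := hc 0 (by simp)
  have h1 := hc t (hI ▸ ht)
  simp only [Pi.sub_apply, intervalIntegral.integral_same, sub_zero] at h0 h1
  rw [h0, ← h1]; abel

/-- Composition of an `L²` function with a `C¹` diffeomorphism of `[0,1]`. -/
lemma memLp_comp_smul {φ φ' : ℝ → ℝ} (hφ : ∀ t, HasDerivAt φ (φ' t) t) (hc : Continuous φ')
    (hpos : ∀ t, 0 < φ' t) (h0 : φ 0 = 0) (h1 : φ 1 = 1) {g : ℝ → F}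
    (hg : MemLp g 2 (volume.restrict (Icc 0 1))) :
    MemLp (fun s => φ' s • g (φ s)) 2 (volume.restrict (Icc 0 1)) := by
  have hcont : ContinuousOn φ (Icc 0 1) := fun t _ => (hφ t).continuousAt.continuousWithinAt
  have i1 : IntegrableOn (fun s => φ' s • g (φ s)) (Icc 0 1) := by
    rw [integrableOn_Icc_deriv_smul_iff_of_deriv_nonneg hcont (fun t _ => hφ t)
      (fun t _ => (hpos t).le) zero_le_one, h0, h1]
    exact hg.integrable (by norm_num)
  have i2 : IntegrableOn (fun s => φ' s • ‖g (φ s)‖ ^ 2) (Icc 0 1) := by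
    rw [integrableOn_Icc_deriv_smul_iff_of_deriv_nonneg (g := fun s => ‖g s‖ ^ 2) hcont
      (fun t _ => hφ t) (fun t _ => (hpos t).le) zero_le_one, h0, h1]
    exact hg.norm.integrable_sq
  have haes : AEStronglyMeasurable (fun s => φ' s • g (φ s)) (volume.restrict (Icc 0 1)) := i1.1
  refine (memLp_two_iff_integrable_sq_norm haes).2 ?_
  -- The change of variables absorbs only one factor φ' of ‖φ' g(φ)‖²; the other is continuous, so
  -- bounded on [0,1].
  have := i2.continuousOn_mul hc.continuousOn isCompact_Icc
  refine this.congr (Eventually.of_forall fun s => ?_)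
  simp only [norm_smul, Real.norm_eq_abs, abs_of_pos (hpos s), smul_eq_mul]
  ring

lemma integral_comp_smul {φ φ' : ℝ → ℝ} (hφ : ∀ t, HasDerivAt φ (φ' t) t)
    (hpos : ∀ t, 0 < φ' t) (h0 : φ 0 = 0) (g : ℝ → F) {t : ℝ} (ht : 0 ≤ t) :
    ∫ s in (0 : ℝ)..φ t, g s = ∫ s in (0 : ℝ)..t, φ' s • g (φ s) := by
  have hcont : ContinuousOn φ (Icc 0 t) := fun t _ => (hφ t).continuousAt.continuousWithinAt
  have hmono : StrictMono φ := strictMono_of_deriv_pos fun t => by rw [(hφ t).deriv]; exact hpos t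
  have := integral_Icc_deriv_smul_of_deriv_nonneg (g := g) hcont (fun t _ => hφ t)
      (fun t _ => (hpos t).le) ht
  rw [h0] at this
  rw [intervalIntegral.integral_of_le ht, intervalIntegral.integral_of_le
    (h0 ▸ hmono.monotone ht), ← integral_Icc_eq_integral_Ioc, ← integral_Icc_eq_integral_Ioc, this]

end Calculus

/-! ### Constant speed reparametrization -/

section ConstantSpeed

variable {d : ℕ}

lemma IsReparam.apply_fin_two {F : Type*} [NormedAddCommGroup F] [NormedSpace ℝ F]
    {γ' γ : ℝ → F} (h : IsReparam γ' γ) (z : Fin 2) :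
    γ' ((z : ℕ) : ℝ) = γ ((z : ℕ) : ℝ) := by
  obtain ⟨φ, -, h0, h1, -, h⟩ := h
  rw [h _ (fin_two_mem_unit z)]
  fin_cases z <;> simp [h0, h1]

lemma isReparam_refl {F : Type*} [NormedAddCommGroup F] [NormedSpace ℝ F] (γ : ℝ → F) :
    IsReparam γ γ := by
  have h : HasH2 (fun t : ℝ => t) (fun _ => 1) (fun _ => 0) :=
    ⟨fun t _ => hasDerivWithinAt_id t _, MemLp.zero, fun t _ => by simp⟩
  exact ⟨fun t => t, h.isH2, rfl, rfl, fun t ht => by rw [h.vel_eq ht]; exact one_pos, fun t _ => rfl⟩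

lemma IsSingular.hasH2 {F : Type*} [NormedAddCommGroup F] [NormedSpace ℝ F] {γ : ℝ → F}
    (h : IsSingular γ) : HasH2 γ (fun _ => 0) (fun _ => 0) :=
  ⟨fun t ht => (hasDerivWithinAt_const t _ (γ 0)).congr h (h t ht), MemLp.zero,
    fun t _ => by simp⟩

lemma IsSingular.not_isRegular {F : Type*} [NormedAddCommGroup F] [NormedSpace ℝ F] {γ : ℝ → F}
    (h : IsSingular γ) : ¬ IsRegular γ := fun hr =>
  hr.2 0 zero_mem_unit (h.hasH2.vel_eq zero_mem_unit)

lemma IsSingular.curveLength_eq {F : Type*} [NormedAddCommGroup F] [NormedSpace ℝ F] {γ : ℝ → F}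
    (h : IsSingular γ) : curveLength γ = 0 := by
  rw [curveLength, intervalIntegral.integral_congr (g := fun _ => (0 : ℝ))]
  · simp
  · intro t ht
    rw [uIcc_of_le zero_le_one] at ht
    simp [h.hasH2.vel_eq ht]

/-- Normalization is Lipschitz away from the origin, which carries absolute continuity from the
velocity to the unit tangent. -/
lemma norm_inv_smul_sub_le {E : Type*} [NormedAddCommGroup E] [NormedSpace ℝ E] {m : ℝ} (hm : 0 < m)
    {x y : E} (hx : m ≤ ‖x‖) (hy : m ≤ ‖y‖) :
    ‖‖x‖⁻¹ • x - ‖y‖⁻¹ • y‖ ≤ 2 / m * ‖x - y‖ := by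
  have hx0 : 0 < ‖x‖ := hm.trans_le hx
  have hy0 : 0 < ‖y‖ := hm.trans_le hy
  have e : ‖x‖⁻¹ • x - ‖y‖⁻¹ • y = ‖x‖⁻¹ • (x - y) + (‖x‖⁻¹ - ‖y‖⁻¹) • y := by module
  have h1 : ‖(‖x‖⁻¹ - ‖y‖⁻¹) • y‖ ≤ m⁻¹ * ‖x - y‖ := by
    have : ‖x‖⁻¹ - ‖y‖⁻¹ = ‖x‖⁻¹ * (‖y‖ - ‖x‖) * ‖y‖⁻¹ := by field_simp
    rw [norm_smul, this, norm_mul, norm_mul, norm_inv, norm_inv, norm_norm, norm_norm, mul_assoc,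
      inv_mul_cancel₀ hy0.ne', mul_one]
    gcongr
    rw [norm_sub_rev x y]
    exact abs_norm_sub_norm_le y x
  calc _ ≤ ‖x‖⁻¹ * ‖x - y‖ + m⁻¹ * ‖x - y‖ := by
        rw [e]; refine (norm_add_le _ _).trans (add_le_add ?_ h1)
        rw [norm_smul, norm_inv, norm_norm]
    _ ≤ m⁻¹ * ‖x - y‖ + m⁻¹ * ‖x - y‖ := by gcongr
    _ = _ := by ring

lemma abs_inv_norm_sub_le {E : Type*} [NormedAddCommGroup E] {m : ℝ} (hm : 0 < m)
    {x y : E} (hx : m ≤ ‖x‖) (hy : m ≤ ‖y‖) :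
    |‖x‖⁻¹ - ‖y‖⁻¹| ≤ m⁻¹ * m⁻¹ * ‖x - y‖ := by
  have hx0 : 0 < ‖x‖ := hm.trans_le hx
  have hy0 : 0 < ‖y‖ := hm.trans_le hy
  have : ‖x‖⁻¹ - ‖y‖⁻¹ = ‖x‖⁻¹ * ‖y‖⁻¹ * (‖y‖ - ‖x‖) := by field_simp
  rw [this, abs_mul, abs_of_pos (by positivity : 0 < ‖x‖⁻¹ * ‖y‖⁻¹)]
  gcongr
  rw [norm_sub_rev x y]
  exact abs_norm_sub_norm_le y x

lemma absolutelyContinuous_of_dist_le {E E' : Type*} [PseudoMetricSpace E] [PseudoMetricSpace E']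
    {v : ℝ → E} {w : ℝ → E'} {K : ℝ} (hK : 0 ≤ K) (hv : AbsolutelyContinuousOnInterval v 0 1)
    (h : ∀ s ∈ Icc (0 : ℝ) 1, ∀ t ∈ Icc (0 : ℝ) 1, dist (w s) (w t) ≤ K * dist (v s) (v t)) :
    AbsolutelyContinuousOnInterval w 0 1 := by
  have hI : uIcc (0 : ℝ) 1 = Icc 0 1 := uIcc_of_le zero_le_one
  rw [absolutelyContinuousOnInterval_iff] at hv ⊢
  intro ε hε
  -- `K + 1` rather than `K`, since `K` may vanish.
  obtain ⟨δ, hδ, H⟩ := hv (ε / (K + 1)) (by positivity)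
  refine ⟨δ, hδ, fun E hE hsum => ?_⟩
  have h1 := H E hE hsum
  calc _ ≤ ∑ i ∈ Finset.range E.1, K * dist (v (E.2 i).1) (v (E.2 i).2) :=
        Finset.sum_le_sum fun i hi => h _ (hI ▸ (hE.1 i hi).1) _ (hI ▸ (hE.1 i hi).2)
    _ = K * ∑ i ∈ Finset.range E.1, dist (v (E.2 i).1) (v (E.2 i).2) := by rw [Finset.mul_sum]
    _ ≤ K * (ε / (K + 1)) := by gcongr
    _ < (K + 1) * (ε / (K + 1)) := by gcongr; linarith
    _ = ε := by field_simp

lemma absolutelyContinuous_primitive {F : Type*} [NormedAddCommGroup F] [NormedSpace ℝ F]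
    {v g : ℝ → F} (hg : MemLp g 2 (volume.restrict (Icc 0 1)))
    (hv : ∀ t ∈ Icc (0 : ℝ) 1, v t = v 0 + ∫ s in (0 : ℝ)..t, g s) :
    AbsolutelyContinuousOnInterval v 0 1 := by
  have hi := intervalIntegrable_of_memLp hg zero_mem_unit one_mem_unit
  have hn := hi.norm.absolutelyContinuousOnInterval_intervalIntegral (c := 0) (by simp)
  refine absolutelyContinuous_of_dist_le zero_le_one hn fun s hs t ht => ?_
  have hs' := intervalIntegrable_of_memLp hg zero_mem_unit hs
  have ht' := intervalIntegrable_of_memLp hg zero_mem_unit ht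
  rw [one_mul, dist_eq_norm, Real.dist_eq, hv s hs, hv t ht, add_sub_add_left_eq_sub,
    intervalIntegral.integral_interval_sub_left hs' ht',
    intervalIntegral.integral_interval_sub_left hs'.norm ht'.norm]
  exact intervalIntegral.norm_integral_le_abs_integral_norm

/-- A positive continuous function on `[0,1]` with integral `ℓ` is the density of a `C¹`
diffeomorphism, whose inverse is `φ`. -/
lemma exists_inverse_arclength {V : ℝ → ℝ} (hV : ContinuousOn V (Icc 0 1))
    (hpos : ∀ t ∈ Icc (0 : ℝ) 1, 0 < V t) {ℓ : ℝ} (hℓ : ℓ = ∫ t in (0 : ℝ)..1, V t) :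
    0 < ℓ ∧ ∃ φ φ' : ℝ → ℝ, (∀ t, HasDerivAt φ (φ' t) t) ∧ Continuous φ' ∧ (∀ t, 0 < φ' t) ∧
      φ 0 = 0 ∧ φ 1 = 1 ∧ ∀ t ∈ Icc (0 : ℝ) 1, φ t ∈ Icc (0 : ℝ) 1 ∧ φ' t = ℓ / V (φ t) := by
  have hℓ0 : 0 < ℓ := by
    rw [hℓ]
    refine intervalIntegral.intervalIntegral_pos_of_pos_on
      (hV.intervalIntegrable_of_Icc zero_le_one) (fun t ht => hpos t (Ioo_subset_Icc_self ht))
      one_pos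
  refine ⟨hℓ0, ?_⟩
  -- Extending V by its endpoint values makes the normalized arclength σ a C¹ function on all of ℝ,
  -- so no one-sided derivatives occur when it is inverted.
  set W : ℝ → ℝ := IccExtend zero_le_one ((Icc (0 : ℝ) 1).domRestrict V) with hW
  have hWc : Continuous W := (continuousOn_iff_continuous_domRestrict.1 hV).Icc_extend'
  have hWV : ∀ t ∈ Icc (0 : ℝ) 1, W t = V t := fun t ht => by
    rw [hW, IccExtend_of_mem _ _ ht]; rfl
  have hWpos : ∀ t, 0 < W t := fun t => hpos _ (projIcc (0 : ℝ) 1 zero_le_one t).2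
  obtain ⟨m, hm0, hm⟩ : ∃ m > 0, ∀ t, m ≤ W t := by
    obtain ⟨x, hx, hmin⟩ := isCompact_Icc.exists_isMinOn (nonempty_Icc.2 zero_le_one) hV
    exact ⟨V x, hpos x hx, fun t => hmin (projIcc (0 : ℝ) 1 zero_le_one t).2⟩
  set σ : ℝ → ℝ := fun t => (∫ s in (0 : ℝ)..t, W s) / ℓ with hσ
  have hσd : ∀ t, HasDerivAt σ (W t / ℓ) t := fun t =>
    (intervalIntegral.integral_hasDerivAt_right (hWc.intervalIntegrable _ _)
      (hWc.stronglyMeasurableAtFilter _ _) hWc.continuousAt).div_const ℓ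
  have hσmono : StrictMono σ := strictMono_of_deriv_pos fun t => by
    rw [(hσd t).deriv]; exact div_pos (hWpos t) hℓ0
  have hσc : Continuous σ := continuous_iff_continuousAt.2 fun t => (hσd t).continuousAt
  have hσ0 : σ 0 = 0 := by simp [hσ]
  have hσ1 : σ 1 = 1 := by
    have : ∫ s in (0 : ℝ)..1, W s = ℓ := by
      rw [hℓ]
      exact intervalIntegral.integral_congr fun t ht => hWV t (by rwa [uIcc_of_le zero_le_one] at ht)
    simp only [hσ, this]; exact div_self hℓ0.ne'
  -- Linear growth in both directions gives surjectivity of σ.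
  have hlow : ∀ s t, s ≤ t → m / ℓ * (t - s) ≤ σ t - σ s := by
    intro s t hst
    refine Convex.mul_sub_le_image_sub_of_le_deriv (convex_univ) hσc.continuousOn
      (fun x _ => (hσd x).differentiableAt.differentiableWithinAt) (fun x _ => ?_) s (mem_univ _) t
      (mem_univ _) hst
    rw [(hσd x).deriv]
    gcongr
    exact hm x
  have hml : 0 < m / ℓ := by positivity
  have hsurj : Function.Surjective σ := by
    refine hσc.surjective ?_ ?_
    · refine tendsto_atTop_mono' atTop (f₁ := fun t => m / ℓ * t) ?_
        (tendsto_id.const_mul_atTop hml)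
      filter_upwards [eventually_ge_atTop 0] with t ht
      have := hlow 0 t ht
      rw [hσ0] at this; linarith
    · refine tendsto_atBot_mono' atBot (?_ : σ ≤ᶠ[atBot] fun t => m / ℓ * t)
        (tendsto_id.const_mul_atBot hml)
      filter_upwards [eventually_le_atBot 0] with t ht
      have := hlow t 0 ht
      rw [hσ0] at this; linarith
  set Φ := hσmono.orderIsoOfSurjective σ hsurj with hΦ
  have hΦσ : ∀ t, Φ.symm (σ t) = t := fun t => Φ.symm_apply_apply t
  have hσΦ : ∀ t, σ (Φ.symm t) = t := fun t => Φ.apply_symm_apply t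
  have hc : Continuous Φ.symm := Φ.symm.continuous
  have hd : ∀ t, HasDerivAt Φ.symm (W (Φ.symm t) / ℓ)⁻¹ t := fun t =>
    HasDerivAt.of_local_left_inverse hc.continuousAt (hσd _)
      (div_pos (hWpos _) hℓ0).ne' (Eventually.of_forall hσΦ)
  have e0 : Φ.symm 0 = 0 := by rw [← hσ0, hΦσ]; exact hσ0.symm
  have e1 : Φ.symm 1 = 1 := by rw [← hσ1, hΦσ]; exact hσ1.symm
  refine ⟨Φ.symm, _, hd, ?_, fun t => inv_pos.2 (div_pos (hWpos _) hℓ0), e0, e1, fun t ht => ?_⟩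
  · exact ((hWc.comp hc).div_const ℓ).inv₀ fun t => (div_pos (hWpos _) hℓ0).ne'
  · have hmem : Φ.symm t ∈ Icc (0 : ℝ) 1 := by
      constructor
      · have := Φ.symm.monotone ht.1; rwa [e0] at this
      · have := Φ.symm.monotone ht.2; rwa [e1] at this
    exact ⟨hmem, by rw [inv_div, hWV _ hmem]⟩

lemma hasDerivAt_inv_norm {v : ℝ → Eucl d} {a : Eucl d} {t : ℝ} (h : HasDerivAt v a t)
    (hv : v t ≠ 0) :
    HasDerivAt (fun s => ‖v s‖⁻¹) (-(inner ℝ a (v t) / ‖v t‖ ^ 3)) t := by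
  have hn : 0 < ‖v t‖ := norm_pos_iff.2 hv
  have h1 : HasDerivAt (fun s => ‖v s‖ ^ 2) (2 * inner ℝ (v t) a) t := h.norm_sq
  have h2 := (h1.sqrt (by positivity)).fun_inv (by
    rw [Real.sqrt_sq hn.le]; exact hn.ne')
  simp only [Real.sqrt_sq (norm_nonneg _)] at h2
  refine h2.congr_deriv ?_
  rw [real_inner_comm]
  field_simp

/-- For `v = vel γ` and `a = acc γ t` this is the Frenet relation: the unit tangent has derivative
`‖v‖ • curvature γ`. -/
lemma hasDerivAt_unit_tangent {v : ℝ → Eucl d} {a : Eucl d} {t : ℝ} (h : HasDerivAt v a t)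
    (hv : v t ≠ 0) :
    HasDerivAt (fun s => ‖v s‖⁻¹ • v s)
      (‖v t‖ • ((‖v t‖ ^ 2)⁻¹ • a - (inner ℝ a (v t) / ‖v t‖ ^ 4) • v t)) t := by
  have hn : 0 < ‖v t‖ := norm_pos_iff.2 hv
  refine ((hasDerivAt_inv_norm h hv).smul h).congr_deriv (Eq.symm ?_)
  rw [smul_sub, smul_smul, smul_smul, sub_eq_add_neg, ← neg_smul]
  congr 2 <;> field_simp

/-- The constant speed reparametrization of a regular curve. -/
theorem IsRegular.exists_constantSpeed {γ : ℝ → Eucl d} (h : IsRegular γ) :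
    0 < curveLength γ ∧ ∃ γ' : ℝ → Eucl d, IsReparam γ' γ ∧ IsH2 γ' ∧
      (∀ t ∈ Icc (0 : ℝ) 1, ‖vel γ' t‖ = curveLength γ) ∧
      (∀ z, vel γ' ((z : Fin 2) : ℕ) = curveLength γ • (‖vel γ (z : ℕ)‖⁻¹ • vel γ (z : ℕ))) ∧
      ∫ t in (0 : ℝ)..1, ‖acc γ' t‖ ^ 2 =
        curveLength γ ^ 3 * ∫ t in (0 : ℝ)..1, ‖curvature γ t‖ ^ 2 * ‖vel γ t‖ := by
  set ℓ := curveLength γ with hℓ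
  have hH := h.1.hasH2
  set v := vel γ with hv
  have hvc : ContinuousOn v (Icc 0 1) := hH.continuousOn_deriv
  have hvpos : ∀ t ∈ Icc (0 : ℝ) 1, 0 < ‖v t‖ := fun t ht => norm_pos_iff.2 (h.2 t ht)
  obtain ⟨hℓ0, φ, φ', hφ, hφc, hφpos, h0, h1, hφI⟩ :=
    exists_inverse_arclength hvc.norm hvpos (ℓ := ℓ) hℓ
  refine ⟨hℓ0, ?_⟩
  obtain ⟨m, hm0, hm⟩ : ∃ m > 0, ∀ t ∈ Icc (0 : ℝ) 1, m ≤ ‖v t‖ := by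
    obtain ⟨x, hx, hmin⟩ := isCompact_Icc.exists_isMinOn (nonempty_Icc.2 zero_le_one) hvc.norm
    exact ⟨‖v x‖, hvpos x hx, fun t ht => hmin ht⟩
  have hvAC : AbsolutelyContinuousOnInterval v 0 1 :=
    absolutelyContinuous_primitive hH.memLp hH.eq_integral
  have hvd := ae_unit_hasDerivAt hH.memLp hH.eq_integral
  have hmeas : AEStronglyMeasurable v (volume.restrict (Icc 0 1)) :=
    hvc.aestronglyMeasurable measurableSet_Icc
  have hma : AEStronglyMeasurable (acc γ) (volume.restrict (Icc 0 1)) := hH.memLp.1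
  have hmI : ∀ᵐ t ∂volume.restrict (Icc (0 : ℝ) 1), t ∈ Icc (0 : ℝ) 1 :=
    ae_restrict_mem measurableSet_Icc
  -- the derivative of `1 / |v|`
  set w' : ℝ → ℝ := fun t => -(inner ℝ (acc γ t) (v t) / ‖v t‖ ^ 3) with hw'
  have hw'L : MemLp w' 2 (volume.restrict (Icc 0 1)) := by
    refine hH.memLp.of_le_mul (c := (m ^ 2)⁻¹) ?_ ?_
    · have hi : AEMeasurable (fun t => inner ℝ (acc γ t) (v t)) (volume.restrict (Icc 0 1)) :=
        (hma.inner hmeas).aemeasurable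
      exact ((hi.div (hmeas.norm.aemeasurable.pow_const 3)).neg).aestronglyMeasurable
    · filter_upwards [hmI] with t ht
      have hp := hvpos t ht
      rw [hw', norm_neg, norm_div, norm_pow, norm_norm]
      calc _ ≤ ‖acc γ t‖ * ‖v t‖ / ‖v t‖ ^ 3 := by gcongr; exact norm_inner_le_norm _ _
        _ = (‖v t‖ ^ 2)⁻¹ * ‖acc γ t‖ := by field_simp
        _ ≤ _ := by gcongr; exact hm t ht
  have hw : ∀ t ∈ Icc (0 : ℝ) 1, ‖v t‖⁻¹ = ‖v 0‖⁻¹ + ∫ s in (0 : ℝ)..t, w' s := by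
    intro t ht
    refine eq_add_integral_of_absolutelyContinuous (f := fun t => ‖v t‖⁻¹) ?_
      (intervalIntegrable_of_memLp hw'L zero_mem_unit one_mem_unit) ?_ ht
    · refine absolutelyContinuous_of_dist_le (K := m⁻¹ * m⁻¹) (by positivity) hvAC
        fun s hs t ht => ?_
      rw [Real.dist_eq, dist_eq_norm]
      exact abs_inv_norm_sub_le hm0 (hm s hs) (hm t ht)
    · filter_upwards [hvd] with t hd ht
      exact hasDerivAt_inv_norm (hd ht).2 (h.2 t ht)
  -- the derivative of the unit tangent
  set T' : ℝ → Eucl d := fun t => ‖v t‖ • curvature γ t with hT'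
  have hT'L : MemLp T' 2 (volume.restrict (Icc 0 1)) := by
    refine hH.memLp.of_le_mul (c := 2 * m⁻¹) ?_ ?_
    · have hi : AEMeasurable (fun t => inner ℝ (acc γ t) (v t)) (volume.restrict (Icc 0 1)) :=
        (hma.inner hmeas).aemeasurable
      have hn := hmeas.norm.aemeasurable
      exact (hn.smul (((hn.pow_const 2).inv.smul hma.aemeasurable).sub
        ((hi.div (hn.pow_const 4)).smul hmeas.aemeasurable))).aestronglyMeasurable
    · filter_upwards [hmI] with t ht
      have hp := hvpos t ht
      have hb : ‖curvature γ t‖ ≤ 2 * (‖v t‖ ^ 2)⁻¹ * ‖acc γ t‖ := by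
        rw [curvature]
        refine (norm_sub_le _ _).trans ?_
        rw [norm_smul, norm_smul, norm_inv, norm_pow, norm_norm, norm_div, norm_pow, norm_norm]
        have : ‖inner ℝ (acc γ t) (v t)‖ / ‖v t‖ ^ 4 * ‖v t‖ ≤ (‖v t‖ ^ 2)⁻¹ * ‖acc γ t‖ := by
          calc _ ≤ ‖acc γ t‖ * ‖v t‖ / ‖v t‖ ^ 4 * ‖v t‖ := by
                gcongr; exact norm_inner_le_norm _ _
            _ = _ := by field_simp
        rw [← hv]; linarith
      rw [hT', norm_smul, norm_norm]
      calc _ ≤ ‖v t‖ * (2 * (‖v t‖ ^ 2)⁻¹ * ‖acc γ t‖) := by gcongr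
        _ = 2 * ‖v t‖⁻¹ * ‖acc γ t‖ := by field_simp
        _ ≤ _ := by gcongr; exact hm t ht
  have hT : ∀ t ∈ Icc (0 : ℝ) 1, ‖v t‖⁻¹ • v t = ‖v 0‖⁻¹ • v 0 + ∫ s in (0 : ℝ)..t, T' s := by
    intro t ht
    refine eq_add_integral_of_absolutelyContinuous (f := fun t => ‖v t‖⁻¹ • v t) ?_
      (intervalIntegrable_of_memLp hT'L zero_mem_unit one_mem_unit) ?_ ht
    · refine absolutelyContinuous_of_dist_le (K := 2 / m) (by positivity) hvAC
        fun s hs t ht => ?_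
      rw [dist_eq_norm, dist_eq_norm]
      exact norm_inv_smul_sub_le hm0 (hm s hs) (hm t ht)
    · filter_upwards [hvd] with t hd ht
      exact hasDerivAt_unit_tangent (hd ht).2 (h.2 t ht)
  -- the reparametrization
  have hφH : HasH2 φ φ' (fun s => ℓ • (φ' s • w' (φ s))) := by
    refine ⟨fun t _ => (hφ t).hasDerivWithinAt,
      (memLp_comp_smul hφ hφc hφpos h0 h1 hw'L).const_smul ℓ, fun t ht => ?_⟩
    rw [intervalIntegral.integral_smul, ← integral_comp_smul hφ hφpos h0 w' ht.1,
      (hφI t ht).2, (hφI 0 zero_mem_unit).2, h0, div_eq_mul_inv, div_eq_mul_inv,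
      hw _ (hφI t ht).1, smul_eq_mul]
    ring
  have hγH : HasH2 (γ ∘ φ) (fun t => ℓ • (‖v (φ t)‖⁻¹ • v (φ t)))
      (fun s => ℓ • (φ' s • T' (φ s))) := by
    refine ⟨fun t ht => ?_, (memLp_comp_smul hφ hφc hφpos h0 h1 hT'L).const_smul ℓ, fun t ht => ?_⟩
    · have := (hH.deriv (φ t) (hφI t ht).1).scomp t (hφ t).hasDerivWithinAt
        (fun s hs => (hφI s hs).1)
      rw [(hφI t ht).2, div_eq_mul_inv, mul_smul] at this
      exact this
    · rw [intervalIntegral.integral_smul, ← integral_comp_smul hφ hφpos h0 T' ht.1, h0,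
        hT _ (hφI t ht).1, smul_add]
  refine ⟨γ ∘ φ, ⟨φ, hφH.isH2, h0, h1, fun t ht => ?_, fun t _ => rfl⟩, hγH.isH2, fun t ht => ?_,
    fun z => ?_, ?_⟩
  · rw [hφH.vel_eq ht]; exact hφpos t
  · rw [hγH.vel_eq ht, norm_smul, norm_smul, norm_inv, norm_norm,
      inv_mul_cancel₀ (hvpos _ (hφI t ht).1).ne', mul_one, Real.norm_of_nonneg hℓ0.le]
  · rw [hγH.vel_eq (fin_two_mem_unit z)]
    have : φ ((z : ℕ) : ℝ) = ((z : ℕ) : ℝ) := by fin_cases z <;> simp [h0, h1]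
    simp only [this]
  · have e1 : ∫ t in (0 : ℝ)..1, ‖acc (γ ∘ φ) t‖ ^ 2 =
        ∫ t in (0 : ℝ)..1, ‖ℓ • (φ' t • T' (φ t))‖ ^ 2 := by
      refine setIntegral_congr_unit ?_ zero_mem_unit one_mem_unit
      filter_upwards [hγH.acc_ae_eq] with t ht
      rw [ht]
    have e2 := integral_comp_smul hφ hφpos h0
      (fun t => ‖curvature γ t‖ ^ 2 * ‖v t‖) zero_le_one
    rw [h1] at e2
    -- Both integrands equal ℓ⁴ |k ∘ φ|², because φ' ‖v ∘ φ‖ = ℓ.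
    rw [e1, e2, ← intervalIntegral.integral_const_mul]
    refine intervalIntegral.integral_congr fun t ht => ?_
    rw [uIcc_of_le zero_le_one] at ht
    have hp := hvpos _ (hφI t ht).1
    simp only [hT', norm_smul, norm_norm, Real.norm_of_nonneg hℓ0.le, Real.norm_of_nonneg
      (hφpos t).le, smul_eq_mul]
    rw [(hφI t ht).2]
    field_simp

end ConstantSpeed

/-! ### Compactness of single curves -/

section Compactness

variable {d : ℕ}

lemma unit_integral_eq {E : Type*} [NormedAddCommGroup E] [NormedSpace ℝ E] (f : ℝ → E) :
    ∫ t in (0 : ℝ)..1, f t = ∫ t, f t ∂volume.restrict (Icc 0 1) := by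
  rw [intervalIntegral.integral_of_le zero_le_one, ← integral_Icc_eq_integral_Ioc]

/-- Bounded sequences in `L²((0,1); ℝ^d)` have weakly convergent subsequences. -/
lemma exists_weakly_convergent_subseq {g : ℕ → ℝ → Eucl d}
    (hg : ∀ n, MemLp (g n) 2 (volume.restrict (Icc 0 1))) {M : ℝ}
    (hM : ∀ n, ∫ t in (0 : ℝ)..1, ‖g n t‖ ^ 2 ≤ M) :
    ∃ k : ℕ → ℕ, StrictMono k ∧ ∃ G : ℝ → Eucl d, MemLp G 2 (volume.restrict (Icc 0 1)) ∧
      ∀ h : ℝ → Eucl d, MemLp h 2 (volume.restrict (Icc 0 1)) →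
        Tendsto (fun n => ∫ t in (0 : ℝ)..1, inner ℝ (g (k n) t) (h t)) atTop
          (𝓝 (∫ t in (0 : ℝ)..1, inner ℝ (G t) (h t))) := by
  set μ := volume.restrict (Icc (0 : ℝ) 1) with hμ
  have : Fact ((2 : ENNReal) ≠ ⊤) := ⟨by norm_num⟩
  let x : ℕ → Lp (Eucl d) 2 μ := fun n => (hg n).toLp (g n)
  have hinner : ∀ (a b : ℝ → Eucl d) (ha : MemLp a 2 μ) (hb : MemLp b 2 μ),
      inner ℝ (ha.toLp a) (hb.toLp b) = ∫ t in (0 : ℝ)..1, inner ℝ (a t) (b t) := by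
    intro a b ha hb
    rw [L2.inner_def, unit_integral_eq]
    refine integral_congr_ae ?_
    filter_upwards [ha.coeFn_toLp, hb.coeFn_toLp] with t h1 h2
    rw [h1, h2]
  have hx : ∀ n, ‖x n‖ ≤ Real.sqrt M := by
    intro n
    refine Real.le_sqrt_of_sq_le ?_
    rw [← real_inner_self_eq_norm_sq, hinner]
    simpa only [real_inner_self_eq_norm_sq] using hM n
  let y : ℕ → WeakDual ℝ (Lp (Eucl d) 2 μ) := fun n =>
    StrongDual.toWeakDual (InnerProductSpace.toDual ℝ _ (x n))
  obtain ⟨y0, -, k, hk, hlim⟩ := WeakDual.isSeqCompact_closedBall ℝ (Lp (Eucl d) 2 μ) 0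
    (Real.sqrt M) (x := y) (fun n => by
      rw [mem_preimage, mem_closedBall_zero_iff]
      have : WeakDual.toStrongDual (y n) = InnerProductSpace.toDual ℝ _ (x n) := rfl
      rw [this, LinearIsometryEquiv.norm_map]
      exact hx n)
  set z : Lp (Eucl d) 2 μ :=
    (InnerProductSpace.toDual ℝ _).symm (WeakDual.toStrongDual y0) with hz
  refine ⟨k, hk, z, Lp.memLp z, fun h hh => ?_⟩
  have h1 := (WeakDual.eval_continuous (hh.toLp h)).continuousAt.tendsto.comp hlim
  have h2 : y0 (hh.toLp h) = inner ℝ z (hh.toLp h) := by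
    rw [hz, InnerProductSpace.toDual_symm_apply]; rfl
  have h3 : inner ℝ z (hh.toLp h) = ∫ t in (0 : ℝ)..1, inner ℝ (z t) (h t) := by
    rw [← hinner _ _ (Lp.memLp z) hh, Lp.toLp_coeFn]
  rw [← h3, ← h2]
  refine h1.congr fun n => ?_
  rw [← hinner _ _ (hg (k n)) hh]
  rfl

/-- Testing weak convergence against the indicator of [0, t] times a fixed vector gives convergence
of each coordinate, which is enough in finite dimension. -/
lemma tendsto_primitive_of_weak {g : ℕ → ℝ → Eucl d} {G : ℝ → Eucl d}
    (hg : ∀ n, MemLp (g n) 2 (volume.restrict (Icc 0 1)))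
    (hG : MemLp G 2 (volume.restrict (Icc 0 1)))
    (hlim : ∀ h : ℝ → Eucl d, MemLp h 2 (volume.restrict (Icc 0 1)) →
        Tendsto (fun n => ∫ t in (0 : ℝ)..1, inner ℝ (g n t) (h t)) atTop
          (𝓝 (∫ t in (0 : ℝ)..1, inner ℝ (G t) (h t)))) {t : ℝ} (ht : t ∈ Icc (0 : ℝ) 1) :
    Tendsto (fun n => ∫ s in (0 : ℝ)..t, g n s) atTop (𝓝 (∫ s in (0 : ℝ)..t, G s)) := by
  have key : ∀ (f : ℝ → Eucl d), MemLp f 2 (volume.restrict (Icc 0 1)) → ∀ c : Eucl d,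
      ∫ s in (0 : ℝ)..1, inner ℝ (f s) ((Icc 0 t).indicator (fun _ => c) s) =
        inner ℝ c (∫ s in (0 : ℝ)..t, f s) := by
    intro f hf c
    have hfi : IntegrableOn f (Icc 0 1) := hf.integrable (by norm_num)
    have e : (fun s => inner ℝ (f s) ((Icc 0 t).indicator (fun _ => c) s)) =
        (Icc 0 t).indicator (fun s => inner ℝ c (f s)) := by
      ext s
      by_cases hs : s ∈ Icc 0 t
      · simp only [indicator_of_mem hs]; exact real_inner_comm _ _
      · simp only [indicator_of_notMem hs, inner_zero_right]
    rw [e, unit_integral_eq, setIntegral_indicator measurableSet_Icc,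
      inter_eq_right.2 (Icc_subset_Icc_right ht.2), intervalIntegral.integral_of_le ht.1,
      ← integral_Icc_eq_integral_Ioc]
    exact integral_inner (hfi.mono_set (Icc_subset_Icc_right ht.2)) c
  have hc : ∀ c : Eucl d, Tendsto (fun n => inner ℝ c (∫ s in (0 : ℝ)..t, g n s)) atTop
      (𝓝 (inner ℝ c (∫ s in (0 : ℝ)..t, G s))) := by
    intro c
    have := hlim ((Icc 0 t).indicator fun _ => c)
      ((memLp_const c).indicator measurableSet_Icc)
    rw [key G hG c] at this
    exact this.congr fun n => key _ (hg n) c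
  rw [(PiLp.homeomorph 2 (fun _ : Fin d => ℝ)).isInducing.tendsto_nhds_iff, tendsto_pi_nhds]
  intro i
  have := hc (EuclideanSpace.single i 1)
  simp only [EuclideanSpace.inner_single_left, map_one, one_mul] at this
  exact this

/-- Dominated convergence; it serves the two lower-order terms of the H² scalar product. -/
lemma tendsto_unit_integral_inner {f : ℕ → ℝ → Eucl d} {g h : ℝ → Eucl d}
    (hf : ∀ n, ContinuousOn (f n) (Icc 0 1)) (hh : ContinuousOn h (Icc 0 1)) {M : ℝ}
    (hM : ∀ n, ∀ t ∈ Icc (0 : ℝ) 1, ‖f n t‖ ≤ M)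
    (hlim : ∀ t ∈ Icc (0 : ℝ) 1, Tendsto (fun n => f n t) atTop (𝓝 (g t))) :
    Tendsto (fun n => ∫ t in (0 : ℝ)..1, inner ℝ (f n t) (h t)) atTop
      (𝓝 (∫ t in (0 : ℝ)..1, inner ℝ (g t) (h t))) := by
  simp only [unit_integral_eq]
  refine tendsto_integral_of_dominated_convergence (fun t => M * ‖h t‖) (fun n => ?_) ?_
    (fun n => ?_) ?_
  · exact ((hf n).inner hh).aestronglyMeasurable measurableSet_Icc
  · exact (continuousOn_const.mul hh.norm).integrableOn_compact isCompact_Icc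
  · filter_upwards [ae_restrict_mem measurableSet_Icc] with t ht
    exact (norm_inner_le_norm _ _).trans (mul_le_mul_of_nonneg_right (hM n t ht) (norm_nonneg _))
  · filter_upwards [ae_restrict_mem measurableSet_Icc] with t ht
    exact (hlim t ht).inner tendsto_const_nhds

lemma HasH2.norm_sub_le_of_deriv_le {F : Type*} [NormedAddCommGroup F] [NormedSpace ℝ F]
    {γ v g : ℝ → F} (h : HasH2 γ v g) {M : ℝ}
    (hM : ∀ t ∈ Icc (0 : ℝ) 1, ‖v t‖ ≤ M) {s t : ℝ} (hs : s ∈ Icc (0 : ℝ) 1)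
    (ht : t ∈ Icc (0 : ℝ) 1) : ‖γ t - γ s‖ ≤ M * |t - s| :=
  (convex_Icc (0 : ℝ) 1).norm_image_sub_le_of_norm_hasDerivWithin_le h.deriv hM hs ht

lemma h2Inner_eq {f g : ℝ → Eucl d} (hf : IsH2 f) (hg : IsH2 g) :
    h2Inner f g = (∫ t in (0 : ℝ)..1, inner ℝ (f t) (g t)) +
      (∫ t in (0 : ℝ)..1, inner ℝ (vel f t) (vel g t)) +
      ∫ t in (0 : ℝ)..1, inner ℝ (acc f t) (acc g t) := by
  have i1 : IntervalIntegrable (fun t => inner ℝ (f t) (g t)) volume 0 1 :=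
    (hf.hasH2.continuousOn.inner hg.hasH2.continuousOn).intervalIntegrable_of_Icc zero_le_one
  have i2 : IntervalIntegrable (fun t => inner ℝ (vel f t) (vel g t)) volume 0 1 :=
    (hf.hasH2.continuousOn_deriv.inner
      hg.hasH2.continuousOn_deriv).intervalIntegrable_of_Icc zero_le_one
  have i3 : IntervalIntegrable (fun t => inner ℝ (acc f t) (acc g t)) volume 0 1 := by
    have h1 : IntegrableOn (fun t => inner ℝ (acc f t) (acc g t)) (Icc 0 1) := by
      have := L2.integrable_inner (𝕜 := ℝ) (hf.2.1.toLp _) (hg.2.1.toLp _)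
      refine this.congr ?_
      filter_upwards [hf.2.1.coeFn_toLp, hg.2.1.coeFn_toLp] with t h1 h2
      rw [h1, h2]
    refine (h1.mono_set ?_).intervalIntegrable
    rw [uIcc_of_le zero_le_one]
  rw [h2Inner, intervalIntegral.integral_add (i1.add i2) i3, intervalIntegral.integral_add i1 i2]

/-- The Arzelà–Ascoli argument: finitely many balls, of a radius given by equicontinuity, reduce
uniform smallness to pointwise convergence at their centres. -/
lemma eventually_forall_norm_le_of_holder {F : Type*} [NormedAddCommGroup F] {w : ℕ → ℝ → F}
    {M : ℝ} (hM : ∀ n, ∀ s ∈ Icc (0 : ℝ) 1, ∀ t ∈ Icc (0 : ℝ) 1,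
      ‖w n s - w n t‖ ≤ M * |s - t| ^ (1 / 2 : ℝ))
    (hlim : ∀ t ∈ Icc (0 : ℝ) 1, Tendsto (fun n => w n t) atTop (𝓝 0)) {ε : ℝ} (hε : 0 < ε) :
    ∀ᶠ n in atTop, ∀ t ∈ Icc (0 : ℝ) 1, ‖w n t‖ ≤ ε := by
  have hcont : Tendsto (fun r : ℝ => M * r ^ (1 / 2 : ℝ)) (𝓝 0) (𝓝 0) := by
    have : Continuous fun r : ℝ => M * r ^ (1 / 2 : ℝ) :=
      continuous_const.mul (Real.continuous_rpow_const (by norm_num))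
    simpa using this.tendsto 0
  obtain ⟨δ, hδ, hδM⟩ := Metric.eventually_nhds_iff.1 (hcont.eventually (gt_mem_nhds (half_pos hε)))
  obtain ⟨S, hS⟩ := isCompact_Icc.elim_nhds_subcover' (s := Icc (0 : ℝ) 1)
    (fun x _ => Metric.ball x δ) (fun x _ => Metric.ball_mem_nhds x hδ)
  have h1 : ∀ᶠ n in atTop, ∀ x ∈ S, ‖w n x‖ < ε / 2 := by
    rw [Finset.eventually_all]
    intro x _
    have := (hlim x x.2).norm
    rw [norm_zero] at this
    exact this.eventually (gt_mem_nhds (half_pos hε))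
  filter_upwards [h1] with n hn t ht
  obtain ⟨x, hx, hxt⟩ := mem_iUnion₂.1 (hS ht)
  have hd : M * |t - x| ^ (1 / 2 : ℝ) < ε / 2 := by
    refine hδM ?_
    rw [Real.dist_eq, sub_zero, abs_abs]
    exact hxt
  have h2 := hM n t ht x x.2
  have h3 := hn x hx
  calc ‖w n t‖ = ‖(w n t - w n x) + w n x‖ := by rw [sub_add_cancel]
    _ ≤ ‖w n t - w n x‖ + ‖w n x‖ := norm_add_le _ _
    _ ≤ ε := by linarith

lemma c1HolderNorm_le {F : Type*} [NormedAddCommGroup F] [NormedSpace ℝ F] {f : ℝ → F} {θ ε : ℝ}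
    (h0 : ∀ t ∈ Icc (0 : ℝ) 1, ‖f t‖ ≤ ε) (h1 : ∀ t ∈ Icc (0 : ℝ) 1, ‖vel f t‖ ≤ ε)
    (h2 : ∀ s ∈ Icc (0 : ℝ) 1, ∀ t ∈ Icc (0 : ℝ) 1, s ≠ t →
      ‖vel f s - vel f t‖ ≤ ε * |s - t| ^ θ) :
    c1HolderNorm θ f ≤ ENNReal.ofReal ε + ENNReal.ofReal ε + ENNReal.ofReal ε := by
  have e : ∀ {x : F} {r : ℝ}, ‖x‖ ≤ r → ‖x‖ₑ ≤ ENNReal.ofReal r := fun hx => by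
    rw [← ofReal_norm]; exact ENNReal.ofReal_le_ofReal hx
  refine add_le_add (add_le_add ?_ ?_) ?_
  · exact iSup₂_le fun t ht => e (h0 t ht)
  · exact iSup₂_le fun t ht => e (h1 t ht)
  · refine iSup₂_le fun s hs => iSup₂_le fun t ht => iSup_le fun hst => ?_
    refine ENNReal.div_le_of_le_mul ?_
    have hε : 0 ≤ ε := (norm_nonneg _).trans (h0 0 zero_mem_unit)
    rw [← ENNReal.ofReal_mul hε]
    exact e (h2 s hs t ht hst)

/-- The interpolation argument: bounds in `C^{1,1/2}` and pointwise convergence of the derivatives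
give convergence in `C^{1,θ}`. -/
lemma tendstoC1Holder_of_pointwise {f : ℕ → ℝ → Eucl d} {g : ℝ → Eucl d}
    (hf : ∀ n, IsH2 (f n)) (hg : IsH2 g) {M : ℝ}
    (hM : ∀ n, ∀ s ∈ Icc (0 : ℝ) 1, ∀ t ∈ Icc (0 : ℝ) 1,
      ‖(vel (f n) s - vel g s) - (vel (f n) t - vel g t)‖ ≤ M * |s - t| ^ (1 / 2 : ℝ))
    (h0 : Tendsto (fun n => f n 0) atTop (𝓝 (g 0)))
    (hlim : ∀ t ∈ Icc (0 : ℝ) 1, Tendsto (fun n => vel (f n) t) atTop (𝓝 (vel g t)))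
    {θ : ℝ} (hθ : θ ∈ Ioo (0 : ℝ) (1 / 2)) : TendstoC1Holder θ f g := by
  have hvel : ∀ n, ∀ t ∈ Icc (0 : ℝ) 1,
      HasDerivWithinAt (fun t => f n t - g t) (vel (f n) t - vel g t) (Icc 0 1) t :=
    fun n t ht => ((hf n).hasDerivWithinAt ht).sub (hg.hasDerivWithinAt ht)
  have hvel' : ∀ n, ∀ t ∈ Icc (0 : ℝ) 1, vel (fun t => f n t - g t) t = vel (f n) t - vel g t :=
    fun n t ht => (hvel n t ht).derivWithin (uniqueDiffWithinAt_unit ht)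
  have hsup : ∀ ε > 0, ∀ᶠ n in atTop, ∀ t ∈ Icc (0 : ℝ) 1, ‖vel (f n) t - vel g t‖ ≤ ε :=
    fun ε hε => eventually_forall_norm_le_of_holder hM
      (fun t ht => by simpa using (hlim t ht).sub_const (vel g t)) hε
  rw [TendstoC1Holder, ENNReal.tendsto_nhds_zero]
  intro η hη
  obtain ⟨ε, hε, hεη⟩ : ∃ ε : ℝ, 0 < ε ∧
      ENNReal.ofReal ε + ENNReal.ofReal ε + ENNReal.ofReal ε ≤ η := by
    have hc : Continuous fun ε : ℝ => ENNReal.ofReal ε + ENNReal.ofReal ε + ENNReal.ofReal ε :=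
      (ENNReal.continuous_ofReal.add ENNReal.continuous_ofReal).add ENNReal.continuous_ofReal
    have h1 := hc.tendsto 0
    simp only [ENNReal.ofReal_zero, add_zero] at h1
    have h2 := (h1.eventually (gt_mem_nhds hη)).filter_mono (nhdsWithin_le_nhds (s := Ioi 0))
    obtain ⟨ε, h3, h4⟩ := (h2.and self_mem_nhdsWithin).exists
    exact ⟨ε, h4, h3.le⟩
  have hexp : 0 < 1 / 2 - θ := by linarith [hθ.2]
  have hcont : Tendsto (fun r : ℝ => M * r ^ (1 / 2 - θ)) (𝓝 0) (𝓝 0) := by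
    have : Continuous fun r : ℝ => M * r ^ (1 / 2 - θ) :=
      continuous_const.mul (Real.continuous_rpow_const hexp.le)
    have h1 := this.tendsto 0
    rwa [Real.zero_rpow hexp.ne', mul_zero] at h1
  obtain ⟨δ, hδ, hδM⟩ := Metric.eventually_nhds_iff.1 (hcont.eventually (gt_mem_nhds hε))
  have hpt : ∀ᶠ n in atTop, ‖f n 0 - g 0‖ < ε / 2 := by
    have := (h0.sub_const (g 0)).norm
    rw [sub_self, norm_zero] at this
    exact this.eventually (gt_mem_nhds (half_pos hε))
  filter_upwards [hpt, hsup (ε / 2) (half_pos hε),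
    hsup (ε * δ ^ θ / 2) (by positivity)] with n hn1 hn2 hn3
  refine (c1HolderNorm_le (fun t ht => ?_) (fun t ht => ?_) fun s hs t ht hst => ?_).trans hεη
  · have h1 := (convex_Icc (0 : ℝ) 1).norm_image_sub_le_of_norm_hasDerivWithin_le (hvel n)
      hn2 zero_mem_unit ht
    rw [sub_zero, Real.norm_of_nonneg ht.1] at h1
    have h2 : ε / 2 * t ≤ ε / 2 := by nlinarith [ht.2]
    have h3 : f n t - g t = (f n t - g t - (f n 0 - g 0)) + (f n 0 - g 0) := by abel
    rw [h3]
    refine (norm_add_le _ _).trans ?_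
    linarith
  · rw [hvel' n t ht]
    linarith [hn2 t ht]
  · rw [hvel' n t ht, hvel' n s hs]
    have hr : 0 < |s - t| := abs_pos.2 (sub_ne_zero.2 hst)
    -- For close points the spare exponent 1/2 - θ makes the uniform Hölder bound small. For distant
    -- points |s - t|^θ ≥ δ^θ, and uniform smallness of the derivatives suffices.
    by_cases hrδ : |s - t| < δ
    · have h1 : M * |s - t| ^ (1 / 2 - θ) < ε := hδM (by rwa [Real.dist_eq, sub_zero, abs_abs])
      refine (hM n s hs t ht).trans ?_
      have : |s - t| ^ (1 / 2 : ℝ) = |s - t| ^ (1 / 2 - θ) * |s - t| ^ θ := by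
        rw [← Real.rpow_add hr]; congr 1; ring
      rw [this, ← mul_assoc]
      gcongr
    · refine (norm_sub_le _ _).trans ?_
      have h1 := hn3 s hs
      have h2 := hn3 t ht
      have h3 : δ ^ θ ≤ |s - t| ^ θ :=
        Real.rpow_le_rpow hδ.le (not_lt.1 hrδ) hθ.1.le
      nlinarith

lemma le_rpow_half {x r B : ℝ} (hr : 0 ≤ r) (h : x ^ 2 ≤ r * B) :
    x ≤ Real.sqrt B * r ^ (1 / 2 : ℝ) := by
  rw [← Real.sqrt_eq_rpow, mul_comm, ← Real.sqrt_mul hr]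
  exact Real.le_sqrt_of_sq_le h

/-- Weak convergence in `H²` and strong convergence in `C^{1,θ}`, `θ < 1/2`. -/
def CurveConverges (f : ℕ → ℝ → Eucl d) (g : ℝ → Eucl d) : Prop :=
  TendstoWeakH2 f g ∧ ∀ θ ∈ Ioo (0 : ℝ) (1 / 2), TendstoC1Holder θ f g

lemma CurveConverges.comp {f : ℕ → ℝ → Eucl d} {g : ℝ → Eucl d} (h : CurveConverges f g)
    {k : ℕ → ℕ} (hk : StrictMono k) : CurveConverges (fun n => f (k n)) g :=
  ⟨⟨fun n => h.1.1 (k n), h.1.2.1, fun φ hφ => (h.1.2.2 φ hφ).comp hk.tendsto_atTop⟩,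
    fun θ hθ => (h.2 θ hθ).comp hk.tendsto_atTop⟩

lemma tendsto_apply_of_tendstoC1Holder {f : ℕ → ℝ → Eucl d} {g : ℝ → Eucl d} {θ : ℝ}
    (h : TendstoC1Holder θ f g) {t : ℝ} (ht : t ∈ Icc (0 : ℝ) 1) :
    Tendsto (fun n => f n t) atTop (𝓝 (g t)) := by
  rw [tendsto_iff_edist_tendsto_0]
  refine tendsto_of_tendsto_of_tendsto_of_le_of_le tendsto_const_nhds h (fun n => zero_le)
    fun n => ?_
  simp only [edist_eq_enorm_sub]
  exact (le_iSup₂ (f := fun t (_ : t ∈ Icc (0 : ℝ) 1) => ‖f n t - g t‖ₑ) t ht).trans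
    (le_self_add.trans le_self_add)

lemma CurveConverges.tendsto_apply {f : ℕ → ℝ → Eucl d} {g : ℝ → Eucl d} (h : CurveConverges f g)
    {t : ℝ} (ht : t ∈ Icc (0 : ℝ) 1) : Tendsto (fun n => f n t) atTop (𝓝 (g t)) :=
  tendsto_apply_of_tendstoC1Holder (h.2 (1 / 4) (by norm_num)) ht

lemma CurveConverges.tendsto_vel {f : ℕ → ℝ → Eucl d} {g : ℝ → Eucl d} (h : CurveConverges f g)
    {t : ℝ} (ht : t ∈ Icc (0 : ℝ) 1) : Tendsto (fun n => vel (f n) t) atTop (𝓝 (vel g t)) := by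
  rw [tendsto_iff_edist_tendsto_0]
  refine tendsto_of_tendsto_of_tendsto_of_le_of_le tendsto_const_nhds (h.2 (1 / 4) (by norm_num))
    (fun n => zero_le) fun n => ?_
  simp only [edist_eq_enorm_sub]
  rw [← (((h.1.1 n).hasDerivWithinAt ht).sub (h.1.2.1.hasDerivWithinAt ht)).derivWithin
    (uniqueDiffWithinAt_unit ht)]
  exact (le_iSup₂ (f := fun t (_ : t ∈ Icc (0 : ℝ) 1) => ‖vel (fun t => f n t - g t) t‖ₑ) t ht).trans
    (le_add_self.trans le_self_add)

/-- Sequences of curves bounded in `H²` are compact. -/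
theorem exists_curveConverges_subseq {f : ℕ → ℝ → Eucl d} (hf : ∀ n, IsH2 (f n)) {M : ℝ}
    (h0 : ∀ n, ‖f n 0‖ ≤ M) (h1 : ∀ n, ‖vel (f n) 0‖ ≤ M)
    (h2 : ∀ n, ∫ t in (0 : ℝ)..1, ‖acc (f n) t‖ ^ 2 ≤ M) :
    ∃ k : ℕ → ℕ, StrictMono k ∧ ∃ g, CurveConverges (fun n => f (k n)) g := by
  obtain ⟨k1, hk1, G, hG, hlim⟩ := exists_weakly_convergent_subseq (fun n => (hf n).2.1) h2
  obtain ⟨c, -, k2, hk2, hc⟩ := tendsto_subseq_of_bounded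
    (Metric.isBounded_closedBall (x := (0 : Eucl d × Eucl d)) (r := M))
    (x := fun n => (f (k1 n) 0, vel (f (k1 n)) 0)) (fun n => by
      rw [mem_closedBall_zero_iff, Prod.norm_def]; exact max_le (h0 _) (h1 _))
  set k := k1 ∘ k2 with hk
  have hkm : StrictMono k := hk1.comp hk2
  have hp : Tendsto (fun n => f (k n) 0) atTop (𝓝 c.1) := (continuous_fst.tendsto c).comp hc
  have ha : Tendsto (fun n => vel (f (k n)) 0) atTop (𝓝 c.2) := (continuous_snd.tendsto c).comp hc
  -- The limit curve is rebuilt from the weak limit `G` of the accelerations by integrating twice,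
  -- starting from the limits of position and velocity at 0.
  set w : ℝ → Eucl d := fun t => c.2 + ∫ s in (0 : ℝ)..t, G s with hw
  have hGi : IntegrableOn G (Icc 0 1) := hG.integrable (by norm_num)
  have hwc : ContinuousOn w (Icc 0 1) := by
    have h2 := intervalIntegral.continuousOn_primitive_interval (a := 0) (b := 1) (f := G)
      (μ := volume) (by rwa [uIcc_of_le zero_le_one])
    rw [uIcc_of_le zero_le_one] at h2
    exact continuousOn_const.add h2
  set W : ℝ → Eucl d := IccExtend zero_le_one ((Icc (0 : ℝ) 1).domRestrict w) with hW
  have hWc : Continuous W := (continuousOn_iff_continuous_domRestrict.1 hwc).Icc_extend'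
  have hWw : ∀ t ∈ Icc (0 : ℝ) 1, W t = w t := fun t ht => by
    rw [hW, IccExtend_of_mem _ _ ht]; rfl
  set g : ℝ → Eucl d := fun t => c.1 + ∫ s in (0 : ℝ)..t, W s with hg
  have hgH : HasH2 g w G := by
    refine ⟨fun t ht => ?_, hG, fun t ht => by simp [hw]⟩
    rw [← hWw t ht]
    exact ((intervalIntegral.integral_hasDerivAt_right (hWc.intervalIntegrable _ _)
      (hWc.stronglyMeasurableAtFilter _ _) hWc.continuousAt).const_add _).hasDerivWithinAt
  have hgI : IsH2 g := hgH.isH2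
  have hg0 : g 0 = c.1 := by simp [hg]
  have hlim' : ∀ h : ℝ → Eucl d, MemLp h 2 (volume.restrict (Icc 0 1)) →
        Tendsto (fun n => ∫ t in (0 : ℝ)..1, inner ℝ (acc (f (k n)) t) (h t)) atTop
          (𝓝 (∫ t in (0 : ℝ)..1, inner ℝ (G t) (h t))) := fun h hh =>
    (hlim h hh).comp hk2.tendsto_atTop
  have hv : ∀ t ∈ Icc (0 : ℝ) 1, Tendsto (fun n => vel (f (k n)) t) atTop (𝓝 (vel g t)) := by
    intro t ht
    rw [hgH.vel_eq ht]
    refine (ha.add (tendsto_primitive_of_weak (fun n => (hf (k n)).2.1) hG hlim' ht)).congr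
      fun n => ?_
    exact ((hf (k n)).2.2 t ht).symm
  have hM0 : 0 ≤ M := (norm_nonneg _).trans (h0 0)
  have hvM : ∀ n, ∀ s ∈ Icc (0 : ℝ) 1, ∀ t ∈ Icc (0 : ℝ) 1,
      ‖vel (f (k n)) s - vel (f (k n)) t‖ ≤ Real.sqrt M * |s - t| ^ (1 / 2 : ℝ) := by
    intro n s hs t ht
    refine le_rpow_half (abs_nonneg _)
      (((hf (k n)).hasH2.norm_sub_sq_le hs ht).trans ?_)
    gcongr
    exact h2 _
  have hgM : ∀ s ∈ Icc (0 : ℝ) 1, ∀ t ∈ Icc (0 : ℝ) 1,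
      ‖vel g s - vel g t‖ ≤ Real.sqrt M * |s - t| ^ (1 / 2 : ℝ) := fun s hs t ht =>
    le_of_tendsto ((hv s hs).sub (hv t ht)).norm (Eventually.of_forall fun n => hvM n s hs t ht)
  have hholder : ∀ θ ∈ Ioo (0 : ℝ) (1 / 2), TendstoC1Holder θ (fun n => f (k n)) g := by
    intro θ hθ
    refine tendstoC1Holder_of_pointwise (M := 2 * Real.sqrt M) (fun n => hf (k n)) hgI
      (fun n s hs t ht => ?_) (by rwa [hg0]) hv hθ
    rw [sub_sub_sub_comm]
    refine (norm_sub_le _ _).trans ?_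
    have h3 := hvM n s hs t ht
    have h4 := hgM s hs t ht
    linarith
  have hvb : ∀ n, ∀ t ∈ Icc (0 : ℝ) 1, ‖vel (f (k n)) t‖ ≤ M + Real.sqrt M := by
    intro n t ht
    have h3 := hvM n t ht 0 zero_mem_unit
    have h4 : |t - 0| ^ (1 / 2 : ℝ) ≤ 1 :=
      Real.rpow_le_one (abs_nonneg _) (by rw [sub_zero, abs_of_nonneg ht.1]; exact ht.2)
        (by norm_num)
    have h5 : Real.sqrt M * |t - 0| ^ (1 / 2 : ℝ) ≤ Real.sqrt M :=
      mul_le_of_le_one_right (Real.sqrt_nonneg _) h4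
    have h6 := norm_le_norm_add_norm_sub' (vel (f (k n)) t) (vel (f (k n)) 0)
    linarith [h1 (k n)]
  have hfb : ∀ n, ∀ t ∈ Icc (0 : ℝ) 1, ‖f (k n) t‖ ≤ M + (M + Real.sqrt M) := by
    intro n t ht
    have h3 := (hf (k n)).hasH2.norm_sub_le_of_deriv_le (hvb n) zero_mem_unit ht
    have h4 : |t - 0| ≤ 1 := by rw [sub_zero, abs_of_nonneg ht.1]; exact ht.2
    have h5 : (M + Real.sqrt M) * |t - 0| ≤ M + Real.sqrt M :=
      mul_le_of_le_one_right (by positivity) h4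
    have h6 := norm_le_norm_add_norm_sub' (f (k n) t) (f (k n) 0)
    linarith [h0 (k n)]
  have hft : ∀ t ∈ Icc (0 : ℝ) 1, Tendsto (fun n => f (k n) t) atTop (𝓝 (g t)) :=
    fun t ht => tendsto_apply_of_tendstoC1Holder (hholder (1 / 4) (by norm_num)) ht
  refine ⟨k, hkm, g, ⟨fun n => hf (k n), hgI, fun φ hφ => ?_⟩, hholder⟩
  simp only [h2Inner_eq (hf _) hφ, h2Inner_eq hgI hφ]
  refine ((tendsto_unit_integral_inner (fun n => (hf (k n)).hasH2.continuousOn)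
    hφ.hasH2.continuousOn hfb hft).add (tendsto_unit_integral_inner
    (fun n => (hf (k n)).hasH2.continuousOn_deriv) hφ.hasH2.continuousOn_deriv hvb hv)).add ?_
  rw [setIntegral_congr_unit (g := fun t => inner ℝ (G t) (acc φ t)) ?_ zero_mem_unit one_mem_unit]
  · exact hlim' _ hφ.2.1
  · filter_upwards [hgH.acc_ae_eq] with t ht
    rw [ht]

end Compactness

/-! ### Stratified-straight subgraphs and their limits -/

section Strata

variable {N d : ℕ}

/-- The families of vectors that are the displacements `x(1,i) - x(0,i)`, `i ∈ H`, of some map `x`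
of the vertices of the subgraph `H`. -/
def displacements (G : NGraph N) (H : Set (Fin N)) : Submodule ℝ (Fin N → Eucl d) where
  carrier := {y | ∃ x : Ends N → Eucl d,
    (∀ z w : Fin 2, ∀ i ∈ H, ∀ j ∈ H, G.r (z, i) (w, j) → x (z, i) = x (w, j)) ∧
    ∀ i ∈ H, x (1, i) - x (0, i) = y i}
  add_mem' := by
    rintro y y' ⟨x, hx, hy⟩ ⟨x', hx', hy'⟩
    refine ⟨x + x', fun z w i hi j hj hr => ?_, fun i hi => ?_⟩
    · simp only [Pi.add_apply, hx z w i hi j hj hr, hx' z w i hi j hj hr]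
    · simp only [Pi.add_apply, ← hy i hi, ← hy' i hi]; abel
  zero_mem' := ⟨0, fun _ _ _ _ _ _ _ => rfl, fun _ _ => by simp⟩
  smul_mem' := by
    rintro c y ⟨x, hx, hy⟩
    refine ⟨c • x, fun z w i hi j hj hr => ?_, fun i hi => ?_⟩
    · simp only [Pi.smul_apply, hx z w i hi j hj hr]
    · simp only [Pi.smul_apply, ← hy i hi, smul_sub]

lemma displacements_anti (G : NGraph N) {H K : Set (Fin N)} (h : K ⊆ H) :
    displacements (d := d) G H ≤ displacements G K := by
  rintro y ⟨x, hx, hy⟩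
  exact ⟨x, fun z w i hi j hj => hx z w i (h hi) j (h hj), fun i hi => hy i (h hi)⟩

lemma displacements_congr (G : NGraph N) {H : Set (Fin N)} {y y' : Fin N → Eucl d}
    (h : ∀ i ∈ H, y i = y' i) (hy : y ∈ displacements G H) : y' ∈ displacements G H := by
  obtain ⟨x, hx, hy⟩ := hy
  exact ⟨x, hx, fun i hi => (hy i hi).trans (h i hi)⟩

/-- The subgraph `H` is stratified-straight with directions of the edges at distance at most `ε`
from `a`, in terms of the lengths `l` and of the directions `u` of the edges of each stratum. -/
inductive Stratified (G : NGraph N) (a : Fin N → Eucl d) (ε : ℝ) : Set (Fin N) → Prop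
  | empty : Stratified G a ε ∅
  | step {H : Set (Fin N)} (l : Fin N → ℝ) (u : Fin N → Eucl d) (hl : ∀ i ∈ H, 0 ≤ l i)
      (hu : ∀ i ∈ H, ‖u i - a i‖ ≤ ε) (hlu : (fun i => l i • u i) ∈ displacements G H)
      (h : Stratified G a ε {i ∈ H | l i = 0}) : Stratified G a ε H

lemma Stratified.mono {G : NGraph N} {a b : Fin N → Eucl d} {ε δ : ℝ} {H : Set (Fin N)}
    (h : Stratified G a ε H) (hab : ∀ i ∈ H, ‖a i - b i‖ + ε ≤ δ) : Stratified G b δ H := by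
  induction h with
  | empty => exact .empty
  | step l u hl hu hlu _ ih =>
    refine .step l u hl (fun i hi => ?_) hlu (ih fun i hi => hab i hi.1)
    have h1 := norm_sub_le_norm_sub_add_norm_sub (u i) (a i) (b i)
    linarith [hu i hi, hab i hi]

/-- A step with all lengths zero leaves `H` unchanged and can be skipped; since the strata end at ∅,
a nonempty `H` must meet a step that removes an edge. -/
lemma Stratified.exists_nontrivial {G : NGraph N} {a : Fin N → Eucl d} {ε : ℝ} {H : Set (Fin N)}
    (h : Stratified G a ε H) (hne : H.Nonempty) :
    ∃ (l : Fin N → ℝ) (u : Fin N → Eucl d), (∀ i ∈ H, 0 ≤ l i) ∧ (∀ i ∈ H, ‖u i - a i‖ ≤ ε) ∧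
      (fun i => l i • u i) ∈ displacements G H ∧ (∃ i ∈ H, l i ≠ 0) ∧
      Stratified G a ε {i ∈ H | l i = 0} := by
  induction h with
  | empty => exact absurd hne not_nonempty_empty
  | @step H l u hl hu hlu hs ih =>
    by_cases h0 : ∃ i ∈ H, l i ≠ 0
    · exact ⟨l, u, hl, hu, hlu, h0, hs⟩
    · push Not at h0
      have hH : {i ∈ H | l i = 0} = H := sep_eq_self_iff_mem_true.2 h0
      rw [hH] at ih
      exact ih hne

/-- Displacements form a linear subspace, so lengths may be rescaled without changing directions or
zero set. Total length 1 prevents the lengths from all tending to zero. -/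
lemma Stratified.exists_normalized {G : NGraph N} {a : Fin N → Eucl d} {ε : ℝ} (hε : 0 ≤ ε)
    {H : Set (Fin N)} (h : Stratified G a ε H) (hne : H.Nonempty) :
    ∃ (l : Fin N → ℝ) (u : Fin N → Eucl d), l ∈ stdSimplex ℝ (Fin N) ∧ (∀ i ∉ H, l i = 0) ∧
      (∀ i, ‖u i - a i‖ ≤ ε) ∧ (fun i => l i • u i) ∈ displacements G H ∧
      Stratified G a ε {i ∈ H | l i = 0} := by
  classical
  obtain ⟨l, u, hl, hu, hlu, ⟨i₀, hi₀, hli₀⟩, hs⟩ := h.exists_nontrivial hne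
  set l' : Fin N → ℝ := fun i => if i ∈ H then l i else 0 with hl'
  have hl'0 : ∀ i, 0 ≤ l' i := fun i => by
    by_cases hi : i ∈ H
    · simpa [hl', hi] using hl i hi
    · simp [hl', hi]
  set s := ∑ i, l' i with hsum
  have hs0 : 0 < s := by
    refine Finset.sum_pos' (fun i _ => hl'0 i) ⟨i₀, Finset.mem_univ _, ?_⟩
    simpa [hl', hi₀] using lt_of_le_of_ne (hl i₀ hi₀) (Ne.symm hli₀)
  refine ⟨fun i => s⁻¹ * l' i, fun i => if i ∈ H then u i else a i, ⟨fun i => ?_, ?_⟩,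
    fun i hi => by simp [hl', hi], fun i => ?_, ?_, ?_⟩
  · exact mul_nonneg (inv_nonneg.2 hs0.le) (hl'0 i)
  · rw [← Finset.mul_sum, ← hsum, inv_mul_cancel₀ hs0.ne']
  · by_cases hi : i ∈ H
    · simpa [hi] using hu i hi
    · simpa [hi] using hε
  · refine displacements_congr G (fun i hi => ?_) ((displacements G H).smul_mem s⁻¹ hlu)
    simp [hl', hi, smul_smul]
  · convert hs using 1
    ext i
    simp only [mem_sep_iff, and_congr_right_iff]
    intro hi
    simp [hl', hi, hs0.ne']

/-- The limit of stratified-straight subgraphs is stratified-straight. -/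
theorem Stratified.of_forall_pos {G : NGraph N} {a : Fin N → Eucl d} {H : Set (Fin N)}
    (h : ∀ ε > 0, Stratified G a ε H) : Stratified G a 0 H := by
  induction hn : H.ncard using Nat.strong_induction_on generalizing H with
  | _ n ih =>
  rcases H.eq_empty_or_nonempty with rfl | hne
  · exact .empty
  have hε : ∀ n : ℕ, (0 : ℝ) < 1 / ((n : ℝ) + 1) := fun n => Nat.one_div_pos_of_nat
  choose l u hl hlH hu hlu hs using fun n : ℕ =>
    (h _ (hε n)).exists_normalized (hε n).le hne
  obtain ⟨L, hL, k, hk, hlim⟩ := (isCompact_stdSimplex ℝ (Fin N)).tendsto_subseq hl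
  have hlimi : ∀ i, Tendsto (fun n => l (k n) i) atTop (𝓝 (L i)) := fun i =>
    (tendsto_pi_nhds.1 hlim) i
  have hεlim : Tendsto (fun n => 1 / ((k n : ℝ) + 1)) atTop (𝓝 0) :=
    tendsto_one_div_add_atTop_nhds_zero_nat.comp hk.tendsto_atTop
  have hulim : ∀ i, Tendsto (fun n => u (k n) i) atTop (𝓝 (a i)) := fun i => by
    rw [tendsto_iff_norm_sub_tendsto_zero]
    exact squeeze_zero (fun _ => norm_nonneg _) (fun n => hu (k n) i) hεlim
  -- A finite-dimensional subspace is closed, so being a displacement family survives the limit.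
  have hmem : (fun i => L i • a i) ∈ displacements G H :=
    (displacements G H).closed_of_finiteDimensional.mem_of_tendsto
      (tendsto_pi_nhds.2 fun i => (hlimi i).smul (hulim i))
      (Eventually.of_forall fun n => hlu (k n))
  have hLH : ∀ i ∉ H, L i = 0 := fun i hi =>
    tendsto_nhds_unique (hlimi i) (by simp only [hlH _ i hi]; exact tendsto_const_nhds)
  obtain ⟨i₀, hi₀⟩ : ∃ i, L i ≠ 0 := by
    by_contra! h0
    have := hL.2
    simp [h0] at this
  have hi₀H : i₀ ∈ H := by
    by_contra hi
    exact hi₀ (hLH i₀ hi)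
  refine .step L a (fun i _ => hL.1 i) (fun i _ => by simp) hmem (ih _ ?_ (fun ε hε' => ?_) rfl)
  · rw [← hn]
    exact ncard_lt_ncard ⟨sep_subset _ _, fun hsub => hi₀ (hsub hi₀H).2⟩ (toFinite _)
  -- Edges with L ≠ 0 eventually have nonzero approximating length. Thus the zero set of `l (k n)`
  -- lies in that of `L`, and restricting step n to {L = 0} leaves the same next stratum as before,
  -- which keeps {L = 0} approximately stratified.
  · have hev : ∀ᶠ n in atTop, ∀ i, L i ≠ 0 → l (k n) i ≠ 0 := by
      rw [eventually_all]
      intro i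
      by_cases hi : L i = 0
      · simp [hi]
      · filter_upwards [(hlimi i).eventually_ne hi] with n hn _ using hn
    obtain ⟨n, hn1, hn2⟩ := (hev.and (hεlim.eventually (gt_mem_nhds hε'))).exists
    have hsub : {i ∈ H | l (k n) i = 0} ⊆ {i ∈ H | L i = 0} := fun i hi =>
      ⟨hi.1, by_contra fun h => hn1 i h hi.2⟩
    refine .step (l (k n)) (u (k n)) (fun i _ => (hl _).1 i) (fun i _ => (hu _ i).trans hn2.le)
      (displacements_anti G (sep_subset _ _) (hlu _)) ?_
    have he : {i ∈ {i ∈ H | L i = 0} | l (k n) i = 0} = {i ∈ H | l (k n) i = 0} := by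
      ext i
      exact ⟨fun hi => ⟨hi.1.1, hi.2⟩, fun hi => ⟨hsub hi, hi.2⟩⟩
    rw [he]
    exact (hs (k n)).mono fun i _ => by simpa using hn2.le

lemma norm_outerTangent {F : Type*} [NormedAddCommGroup F] [NormedSpace ℝ F] {γ : ℝ → F}
    (h : IsRegular γ) (z : Fin 2) : ‖outerTangent γ z‖ = 1 := by
  have := norm_pos_iff.2 (h.2 _ (fin_two_mem_unit z))
  rw [outerTangent, norm_smul, norm_smul, norm_pow, norm_neg, norm_one, one_pow, one_mul, norm_inv,
    norm_norm, inv_mul_cancel₀ this.ne']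

lemma outerTangent_zero {F : Type*} [NormedAddCommGroup F] [NormedSpace ℝ F] (γ : ℝ → F) :
    outerTangent γ 0 = ‖vel γ 0‖⁻¹ • vel γ 0 := by
  simp [outerTangent]

lemma outerTangent_one {F : Type*} [NormedAddCommGroup F] [NormedSpace ℝ F] (γ : ℝ → F) :
    outerTangent γ 1 = -(‖vel γ 1‖⁻¹ • vel γ 1) := by
  simp [outerTangent]

/-- A regular curve whose image is a segment starts in the direction of the segment. -/
lemma IsRegular.outerTangent_of_isSegment {γ : ℝ → Eucl d} (h : IsRegular γ) (hs : IsSegment γ) :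
    γ 1 - γ 0 ≠ 0 ∧ γ 1 - γ 0 = ‖γ 1 - γ 0‖ • outerTangent γ 0 := by
  have hd := h.1.hasDerivWithinAt zero_mem_unit
  have hseg : ∀ t ∈ Icc (0 : ℝ) 1, ∃ θ ∈ Icc (0 : ℝ) 1, γ 0 + θ • (γ 1 - γ 0) = γ t := by
    intro t ht
    have : γ t ∈ segment ℝ (γ 0) (γ 1) := hs ▸ mem_image_of_mem γ ht
    rw [segment_eq_image'] at this
    exact this
  set e := γ 1 - γ 0 with he
  have he0 : e ≠ 0 := by
    intro h0
    refine h.2 0 zero_mem_unit ?_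
    have : IsSingular γ := fun t ht => by
      obtain ⟨θ, -, hθ⟩ := hseg t ht
      rw [← hθ, h0, smul_zero, add_zero]
    exact this.hasH2.vel_eq zero_mem_unit
  refine ⟨he0, ?_⟩
  -- Difference quotients at 0 lie on the closed ray spanned by the chord, hence so does their
  -- limit.
  have hray : vel γ 0 ∈ (fun c : ℝ => c • e) '' Ici 0 := by
    have hclosed : IsClosed ((fun c : ℝ => c • e) '' Ici 0) :=
      (isClosedEmbedding_smul_left he0).isClosedMap _ isClosed_Ici
    have hslope := (hasDerivWithinAt_iff_tendsto_slope.1 hd)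
    have hne : (𝓝[Icc (0 : ℝ) 1 \ {0}] 0).NeBot := by
      rw [Icc_sdiff_left]
      exact mem_closure_iff_nhdsWithin_neBot.1 (by
        rw [closure_Ioc (zero_ne_one)]; exact zero_mem_unit)
    refine hclosed.mem_of_tendsto hslope ?_
    filter_upwards [self_mem_nhdsWithin] with t ht
    obtain ⟨θ, hθ, hθt⟩ := hseg t ht.1
    refine ⟨(t - 0)⁻¹ * θ, mul_nonneg (inv_nonneg.2 (sub_nonneg.2 ht.1.1)) hθ.1, ?_⟩
    rw [slope, ← hθt, vsub_eq_sub, add_sub_cancel_left, smul_smul]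
  obtain ⟨c, hc, hce⟩ := hray
  have hc0 : 0 < c := by
    refine lt_of_le_of_ne hc fun h0 => h.2 0 zero_mem_unit ?_
    rw [← hce, ← h0]; simp
  have hen : 0 < ‖e‖ := norm_pos_iff.2 he0
  rw [outerTangent_zero, ← hce]
  simp only [norm_smul, Real.norm_of_nonneg hc0.le, smul_smul]
  have : ‖e‖ * ((c * ‖e‖)⁻¹ * c) = 1 := by field_simp
  rw [← mul_assoc] at this
  rw [← mul_assoc, this, one_smul]

/-- A regular straight curve displaces its endpoints by its chord length times its initial tangent,
and a singular one by zero; chord lengths and tangents are therefore the required data. -/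
lemma StratifiedStraight.stratified {G : NGraph N} {D : Ends N → Metric.sphere (0 : Eucl d) 1}
    {τ : Ends N → Eucl d} {H : Set (Fin N)} (h : StratifiedStraight G D τ H) :
    Stratified G (fun i => τ (0, i)) 0 H := by
  obtain ⟨q, K, S, rfl, hq, hK⟩ := h
  -- Induction upwards from the last stratum, which is empty.
  have key : ∀ m ≤ q, Stratified G (fun i => τ (0, i)) 0 (K (q - m)) := by
    intro m
    induction m with
    | zero => intro _; rw [Nat.sub_zero, hq]; exact .empty
    | succ m ih =>
      intro hm
      obtain ⟨hnet, hang, hseg, hsucc⟩ := hK (q - (m + 1)) (by omega)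
      have ih := ih (by omega)
      rw [show q - m = q - (m + 1) + 1 by omega, hsucc] at ih
      set j := q - (m + 1)
      have hreg : ∀ i ∈ K j, ¬ IsSingular (S j i) → S j i 1 - S j i 0 ≠ 0 ∧
          S j i 1 - S j i 0 = ‖S j i 1 - S j i 0‖ • τ (0, i) := by
        intro i hi hns
        have hr := (hnet.1 i hi).resolve_left hns
        rw [hang.1 i hi hr]
        exact hr.outerTangent_of_isSegment (hseg i hi hr)
      have hsing : ∀ i, IsSingular (S j i) → S j i 1 - S j i 0 = 0 := fun i hi => by
        rw [hi 1 one_mem_unit, sub_self]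
      refine .step (fun i => ‖S j i 1 - S j i 0‖) (fun i => τ (0, i)) (fun i _ => norm_nonneg _)
        (fun i _ => by simp) ?_ ?_
      · refine ⟨fun e => S j e.2 ((e.1 : ℕ) : ℝ), fun z w i hi k hk hr => hnet.2 z w i hi k hk hr,
          fun i hi => ?_⟩
        simp only [Fin.val_one, Fin.val_zero, Nat.cast_one, Nat.cast_zero]
        by_cases hs : IsSingular (S j i)
        · rw [hsing i hs]; simp
        · exact (hreg i hi hs).2
      · convert ih using 1
        ext i
        simp only [mem_sep_iff, Sing, and_congr_right_iff, norm_eq_zero]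
        intro hi
        exact ⟨fun h0 => by_contra fun hs => (hreg i hi hs).1 h0, hsing i⟩
  simpa using key q le_rfl

lemma hasH2_affine (p w : Eucl d) : HasH2 (fun t : ℝ => p + t • w) (fun _ => w) (fun _ => 0) :=
  ⟨fun t _ => by simpa using (((hasDerivAt_id t).smul_const w).const_add p).hasDerivWithinAt,
    MemLp.zero, fun t _ => by simp⟩

lemma IsRotated.mono {G : NGraph N} {D : Ends N → Metric.sphere (0 : Eucl d) 1}
    {H K : Set (Fin N)} {τ : Ends N → Eucl d} (h : IsRotated G D H τ) (hK : K ⊆ H) :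
    IsRotated G D K τ := fun p => by
  obtain ⟨R, hR, h⟩ := h p
  exact ⟨R, hR, fun z i hi => h z i (hK hi)⟩

/-- With error 0 the directions are exactly the tangents, so affine curves between the images of the
vertices realize each stratum. -/
lemma Stratified.stratifiedStraight {G : NGraph N} {D : Ends N → Metric.sphere (0 : Eucl d) 1}
    {τ : Ends N → Eucl d} {H : Set (Fin N)} (h : Stratified G (fun i => τ (0, i)) 0 H)
    (hn : ∀ i ∈ H, ∀ z, ‖τ (z, i)‖ = 1) (hopp : ∀ i ∈ H, τ (0, i) = -τ (1, i))
    (hrot : IsRotated G D H τ) : StratifiedStraight G D τ H := by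
  induction h with
  | empty => exact ⟨0, fun _ => ∅, fun _ _ _ => 0, rfl, rfl, fun j hj => absurd hj (by omega)⟩
  | @step H l u hl hu hlu hs ih =>
    obtain ⟨q, K, S, hK0, hKq, hK⟩ := ih (fun i hi => hn i hi.1) (fun i hi => hopp i hi.1)
      (hrot.mono (sep_subset _ _))
    obtain ⟨x, hx, hxu⟩ := hlu
    have hxτ : ∀ i ∈ H, x (1, i) - x (0, i) = l i • τ (0, i) := fun i hi => by
      rw [hxu i hi, ← sub_eq_zero.1 (norm_le_zero_iff.1 (hu i hi))]
    set c : Fin N → ℝ → Eucl d := fun i t => x (0, i) + t • (x (1, i) - x (0, i)) with hc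
    have hcH := fun i => hasH2_affine (x (0, i)) (x (1, i) - x (0, i))
    have hτ0 : ∀ i ∈ H, τ (0, i) ≠ 0 := fun i hi h0 => by
      have := hn i hi 0
      rw [h0, norm_zero] at this
      exact zero_ne_one this
    have hsing : ∀ i ∈ H, IsSingular (c i) ↔ l i = 0 := by
      intro i hi
      constructor
      · intro h
        have := h 1 one_mem_unit
        simp only [hc, one_smul, zero_smul, add_zero, add_eq_left, hxτ i hi] at this
        exact (smul_eq_zero.1 this).resolve_right (hτ0 i hi)
      · intro h0 t _
        simp [hc, hxτ i hi, h0]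
    have hreg : ∀ i ∈ H, l i ≠ 0 → IsRegular (c i) := fun i hi h0 =>
      ⟨(hcH i).isH2, fun t ht => by
        rw [(hcH i).vel_eq ht, hxτ i hi]
        exact smul_ne_zero h0 (hτ0 i hi)⟩
    have hc0 : ∀ i, c i 0 = x (0, i) := fun i => by simp [hc]
    have hc1 : ∀ i, c i 1 = x (1, i) := fun i => by simp [hc]
    have hcz : ∀ i (z : Fin 2), c i ((z : ℕ) : ℝ) = x (z, i) := fun i z => by
      fin_cases z <;> simp [hc]
    have hstr : IsNetwork G H c ∧ AngleCondition G D H c τ ∧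
        (∀ i ∈ H, IsRegular (c i) → IsSegment (c i)) := by
      refine ⟨⟨fun i hi => ?_, fun z w i hi j hj hr => ?_⟩, ⟨fun i hi hr z => ?_,
        fun i hi _ => ⟨hn i hi, hopp i hi⟩, hrot⟩, fun i hi _ => ?_⟩
      · by_cases h0 : l i = 0
        · exact .inl ((hsing i hi).2 h0)
        · exact .inr (hreg i hi h0)
      · rw [hcz, hcz]; exact hx z w i hi j hj hr
      · have hli : 0 < l i := lt_of_le_of_ne (hl i hi) fun h0 =>
          ((hsing i hi).2 h0.symm).not_isRegular hr
        have e : ∀ t ∈ Icc (0 : ℝ) 1, ‖vel (c i) t‖⁻¹ • vel (c i) t = τ (0, i) := fun t ht => by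
          rw [(hcH i).vel_eq ht, hxτ i hi, norm_smul, hn i hi, mul_one, Real.norm_of_nonneg hli.le,
            inv_smul_smul₀ hli.ne']
        fin_cases z
        · simpa [outerTangent] using (e 0 zero_mem_unit).symm
        · have := e 1 one_mem_unit
          simp only [Fin.mk_one, outerTangent_one, this, hopp i hi, neg_neg]
      · rw [IsSegment, segment_eq_image', hc0, hc1]
    -- The new stratum is put in front of the inductively given ones, shifting their indices by one.
    refine ⟨q + 1, fun j => Nat.casesOn j H K, fun j => Nat.casesOn j c S, rfl, hKq, fun j hj => ?_⟩
    cases j with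
    | zero =>
      refine ⟨hstr.1, hstr.2.1, hstr.2.2, ?_⟩
      change K 0 = Sing H c
      rw [hK0]
      ext i
      simp only [mem_sep_iff, Sing, and_congr_right_iff]
      exact fun hi => (hsing i hi).symm
    | succ j => exact hK j (by omega)

end Strata

/-! ### Passage to the limit for networks -/

section Main

variable {N d : ℕ}

lemma isCompact_specialOrthogonalGroup :
    IsCompact (Matrix.specialOrthogonalGroup (Fin d) ℝ : Set (Matrix (Fin d) (Fin d) ℝ)) := by
  have hK : IsCompact (univ.pi fun _ : Fin d => univ.pi fun _ : Fin d => Icc (-1 : ℝ) 1) :=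
    isCompact_univ_pi fun i => isCompact_univ_pi fun j => isCompact_Icc
  refine IsCompact.of_isClosed_subset (X := Matrix (Fin d) (Fin d) ℝ) hK ?_ ?_
  · have : (Matrix.specialOrthogonalGroup (Fin d) ℝ : Set (Matrix (Fin d) (Fin d) ℝ)) =
        {A | A * A.transpose = 1} ∩ {A | A.det = 1} := by
      ext A
      simp [Matrix.mem_specialOrthogonalGroup_iff, Matrix.mem_orthogonalGroup_iff]
    rw [this]
    exact (isClosed_eq (continuous_id.matrix_mul continuous_id.matrix_transpose)
      continuous_const).inter (isClosed_eq continuous_id.matrix_det continuous_const)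
  · intro A hA i _ j _
    have h1 := (Matrix.mem_specialOrthogonalGroup_iff.1 hA).1
    exact abs_le.1 (entry_norm_bound_of_unitary h1 i j)

/-- At each vertex the admissible tangents are the continuous image of the compact group SO(d),
hence a closed set. -/
lemma isClosed_setOf_isRotated (G : NGraph N) (D : Ends N → Metric.sphere (0 : Eucl d) 1)
    (H : Set (Fin N)) : IsClosed {τ : Ends N → Eucl d | IsRotated G D H τ} := by
  simp only [IsRotated, ofPred_forall]
  refine isClosed_iInter fun p => ?_
  let P : Type := {e : Ends N // e.2 ∈ H ∧ Quotient.mk G e = p}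
  let ρ : (Ends N → Eucl d) → P → Eucl d := fun τ e => τ e.1
  let Φ : Matrix (Fin d) (Fin d) ℝ → P → Eucl d := fun R e =>
    Matrix.toEuclideanLin R (D e.1 : Eucl d)
  have hρ : Continuous ρ := continuous_pi fun e => continuous_apply e.1
  have hΦ : Continuous Φ := continuous_pi fun e => by
    change Continuous fun R : Matrix (Fin d) (Fin d) ℝ =>
      Matrix.toEuclideanLin R (D e.1 : Eucl d)
    simp only [Matrix.toLpLin_apply]
    exact (PiLp.continuous_toLp 2 _).comp (continuous_id.matrix_mulVec continuous_const)
  have hc := ((isCompact_specialOrthogonalGroup.image hΦ).isClosed.preimage hρ)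
  convert hc using 1
  ext τ
  constructor
  · rintro ⟨R, hR, h⟩
    exact ⟨R, hR, funext fun e => (h e.1.1 e.1.2 e.2.1 e.2.2).symm⟩
  · rintro ⟨R, hR, h⟩
    exact ⟨R, hR, fun z i hi hp => (congrFun h ⟨(z, i), hi, hp⟩).symm⟩

/-- Every curve of a network has a constant speed reparametrization. -/
lemma exists_constantSpeed {γ : ℝ → Eucl d} (h : IsSingular γ ∨ IsRegular γ) :
    ∃ γ' : ℝ → Eucl d, IsReparam γ' γ ∧ IsH2 γ' ∧
      (∀ t ∈ Icc (0 : ℝ) 1, ‖vel γ' t‖ = curveLength γ) ∧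
      (IsRegular γ → ∀ z, vel γ' ((z : Fin 2) : ℕ) =
        curveLength γ • (‖vel γ (z : ℕ)‖⁻¹ • vel γ (z : ℕ))) ∧
      ∫ t in (0 : ℝ)..1, ‖acc γ' t‖ ^ 2 =
        curveLength γ ^ 3 * ∫ t in (0 : ℝ)..1, ‖curvature γ t‖ ^ 2 * ‖vel γ t‖ := by
  rcases h with h | h
  · refine ⟨γ, isReparam_refl γ, h.hasH2.isH2, fun t ht => ?_, fun hr => absurd hr h.not_isRegular,
      ?_⟩
    · rw [h.hasH2.vel_eq ht, h.curveLength_eq, norm_zero]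
    · rw [h.curveLength_eq, setIntegral_congr_unit (g := fun _ => (0 : ℝ)) ?_ zero_mem_unit
        one_mem_unit]
      · simp
      · filter_upwards [h.hasH2.acc_ae_eq] with t ht
        simp [ht]
  · obtain ⟨-, γ', h1, h2, h3, h4, h5⟩ := h.exists_constantSpeed
    exact ⟨γ', h1, h2, h3, fun _ => h4, h5⟩

lemma curveLength_nonneg (γ : ℝ → Eucl d) : 0 ≤ curveLength γ :=
  intervalIntegral.integral_nonneg zero_le_one fun _ _ => norm_nonneg _

lemma bending_nonneg (γ : ℝ → Eucl d) :
    0 ≤ ∫ t in (0 : ℝ)..1, ‖curvature γ t‖ ^ 2 * ‖vel γ t‖ :=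
  intervalIntegral.integral_nonneg zero_le_one fun _ _ => by positivity

lemma IsReparam.apply_zero {γ' γ : ℝ → Eucl d} (h : IsReparam γ' γ) : γ' 0 = γ 0 := by
  simpa using h.apply_fin_two 0

lemma IsReparam.apply_one {γ' γ : ℝ → Eucl d} (h : IsReparam γ' γ) : γ' 1 = γ 1 := by
  simpa using h.apply_fin_two 1

lemma norm_chord_le {γ : ℝ → Eucl d} (h : IsSingular γ ∨ IsRegular γ) :
    ‖γ 1 - γ 0‖ ≤ curveLength γ := by
  obtain ⟨γ', hr, hH, hv, -, -⟩ := exists_constantSpeed h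
  have := hH.hasH2.norm_sub_le_of_deriv_le (fun t ht => (hv t ht).le) zero_mem_unit one_mem_unit
  rwa [hr.apply_zero, hr.apply_one, sub_zero, abs_one, mul_one] at this

/-- Short curves of bounded bending energy are almost straight. -/
lemma IsRegular.almost_straight {γ : ℝ → Eucl d} (h : IsRegular γ) {K : ℝ}
    (hK : ∫ t in (0 : ℝ)..1, ‖curvature γ t‖ ^ 2 * ‖vel γ t‖ ≤ K) :
    ‖(curveLength γ)⁻¹ • (γ 1 - γ 0) - outerTangent γ 0‖ ≤ Real.sqrt (curveLength γ * K) ∧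
    ‖outerTangent γ 0 + outerTangent γ 1‖ ≤ Real.sqrt (curveLength γ * K) := by
  obtain ⟨hℓ, γ', hr, hH, -, hz, ha⟩ := h.exists_constantSpeed
  set ℓ := curveLength γ
  have hb : ∀ s ∈ Icc (0 : ℝ) 1, ∀ t ∈ Icc (0 : ℝ) 1,
      ‖vel γ' s - vel γ' t‖ ≤ ℓ * Real.sqrt (ℓ * K) := by
    intro s hs t ht
    have h1 := hH.hasH2.norm_sub_sq_le hs ht
    rw [ha] at h1
    have hst : |s - t| ≤ 1 := abs_le.2 ⟨by linarith [hs.1, ht.2], by linarith [hs.2, ht.1]⟩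
    -- Of the three powers of ℓ, two are cancelled when dividing by the speed; the remaining one
    -- makes the error vanish for short curves.
    have h2 : ‖vel γ' s - vel γ' t‖ ^ 2 ≤ ℓ ^ 2 * (ℓ * K) := by
      refine h1.trans ?_
      have h3 := bending_nonneg γ
      calc _ ≤ 1 * (ℓ ^ 3 * K) := by gcongr
        _ = _ := by ring
    refine (Real.le_sqrt_of_sq_le h2).trans_eq ?_
    rw [Real.sqrt_mul (by positivity), Real.sqrt_sq hℓ.le]
  have hscale : ∀ x : Eucl d, ‖ℓ • x‖ ≤ ℓ * Real.sqrt (ℓ * K) → ‖x‖ ≤ Real.sqrt (ℓ * K) := by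
    intro x hx
    rw [norm_smul, Real.norm_of_nonneg hℓ.le] at hx
    exact le_of_mul_le_mul_left hx hℓ
  have z0 : vel γ' 0 = ℓ • outerTangent γ 0 := by
    have := hz 0
    simpa [outerTangent_zero] using this
  have z1 : vel γ' 1 = -(ℓ • outerTangent γ 1) := by
    have := hz 1
    simpa [outerTangent_one] using this
  constructor
  · refine hscale _ ?_
    have hd : ∀ t ∈ Icc (0 : ℝ) 1, HasDerivWithinAt (fun t => γ' t - t • vel γ' 0)
        (vel γ' t - vel γ' 0) (Icc 0 1) t := fun t ht => by
      have := (hH.hasDerivWithinAt ht).sub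
        ((hasDerivWithinAt_id t (Icc (0 : ℝ) 1)).smul_const (vel γ' 0))
      simpa using! this
    have := (convex_Icc (0 : ℝ) 1).norm_image_sub_le_of_norm_hasDerivWithin_le hd
      (fun t ht => hb t ht 0 zero_mem_unit) zero_mem_unit one_mem_unit
    rw [sub_zero, norm_one, mul_one, one_smul, zero_smul, sub_zero, z0, hr.apply_zero,
      hr.apply_one] at this
    rw [smul_sub, smul_inv_smul₀ hℓ.ne']
    rwa [sub_right_comm] at this
  · refine hscale _ ?_
    have := hb 0 zero_mem_unit 1 one_mem_unit
    rwa [z0, z1, sub_neg_eq_add, ← smul_add] at this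

lemma outerTangent_eq_of_vel_eq {γ γ' : ℝ → Eucl d} {z : Fin 2} {ℓ : ℝ}
    (h : vel γ' ((z : ℕ) : ℝ) = ℓ • (‖vel γ (z : ℕ)‖⁻¹ • vel γ (z : ℕ))) (hℓ : 0 < ℓ) :
    outerTangent γ z = (-1 : ℝ) ^ (z : ℕ) • (ℓ⁻¹ • vel γ' ((z : ℕ) : ℝ)) := by
  rw [h, inv_smul_smul₀ hℓ.ne', outerTangent]

/-- The limit of constant speed parametrizations of degenerate networks of bounded bending energy
is a degenerate network. -/
theorem mem_CDeg_of_curveConverges {G : NGraph N} {D : Ends N → Metric.sphere (0 : Eucl d) 1}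
    {Γ f : ℕ → Fin N → ℝ → Eucl d} {τ : ℕ → Ends N → Eucl d} {T : Ends N → Eucl d}
    {v : ℕ → G.Component → Eucl d} {Γlim : Fin N → ℝ → Eucl d} {K : ℝ}
    (hnet : ∀ n, IsNetwork G univ (Γ n)) (hang : ∀ n, AngleCondition G D univ (Γ n) (τ n))
    (hss : ∀ n, StratifiedStraight G D (τ n) (Sing univ (Γ n)))
    (hK : ∀ n i, ∫ t in (0 : ℝ)..1, ‖curvature (Γ n i) t‖ ^ 2 * ‖vel (Γ n i) t‖ ≤ K)
    (hτ : Tendsto τ atTop (𝓝 T))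
    (hfz : ∀ n i (z : Fin 2), f n i (z : ℕ) = Γ n i (z : ℕ) + v n (G.component i))
    (hfv : ∀ n i, ∀ t ∈ Icc (0 : ℝ) 1, ‖vel (f n i) t‖ = curveLength (Γ n i))
    (hfreg : ∀ n i, IsRegular (Γ n i) → ∀ z : Fin 2, vel (f n i) (z : ℕ) =
      curveLength (Γ n i) • (‖vel (Γ n i) (z : ℕ)‖⁻¹ • vel (Γ n i) (z : ℕ)))
    (hconv : ∀ i, CurveConverges (fun n => f n i) (Γlim i)) : Γlim ∈ CDeg G D := by
  have hdich : ∀ n i, IsSingular (Γ n i) ∨ IsRegular (Γ n i) := fun n i => (hnet n).1 i trivial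
  have hτi : ∀ e, Tendsto (fun n => τ n e) atTop (𝓝 (T e)) := fun e => tendsto_pi_nhds.1 hτ e
  have hτ1 : ∀ n z i, ‖τ n (z, i)‖ = 1 := by
    intro n z i
    rcases hdich n i with h | h
    · exact ((hang n).2.1 i trivial h).1 z
    · rw [(hang n).1 i trivial h z, norm_outerTangent h]
  have hT1 : ∀ z i, ‖T (z, i)‖ = 1 := fun z i =>
    tendsto_nhds_unique (hτi (z, i)).norm (by simp only [hτ1]; exact tendsto_const_nhds)
  have hH2 : ∀ i, IsH2 (Γlim i) := fun i => (hconv i).1.2.1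
  set Λ : Fin N → ℝ := fun i => ‖vel (Γlim i) 0‖ with hΛ
  have hℓlim : ∀ i, ∀ t ∈ Icc (0 : ℝ) 1,
      Tendsto (fun n => curveLength (Γ n i)) atTop (𝓝 ‖vel (Γlim i) t‖) := fun i t ht =>
    ((hconv i).tendsto_vel ht).norm.congr fun n => hfv n i t ht
  -- At every t the limit speed is the limit of the same lengths, so it does not depend on t.
  have hspeed : ∀ i, ∀ t ∈ Icc (0 : ℝ) 1, ‖vel (Γlim i) t‖ = Λ i := fun i t ht =>
    tendsto_nhds_unique (hℓlim i t ht) (hℓlim i 0 zero_mem_unit)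
  have hℓΛ : ∀ i, Tendsto (fun n => curveLength (Γ n i)) atTop (𝓝 (Λ i)) := fun i =>
    hℓlim i 0 zero_mem_unit
  have hlen : ∀ n i, IsRegular (Γ n i) → 0 < curveLength (Γ n i) := fun n i h =>
    h.exists_constantSpeed.1
  have hsing : ∀ i, Λ i = 0 → IsSingular (Γlim i) := by
    intro i hi
    refine constant_of_derivWithin_zero (hH2 i).1 fun t ht => ?_
    have := hspeed i t (Ico_subset_Icc_self ht)
    rw [hi] at this
    exact norm_eq_zero.1 this
  have hreg : ∀ i, Λ i ≠ 0 → IsRegular (Γlim i) := fun i hi =>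
    ⟨hH2 i, fun t ht h0 => hi (by rw [← hspeed i t ht, h0, norm_zero])⟩
  have hsing' : ∀ i, IsSingular (Γlim i) → Λ i = 0 := fun i h => by
    simp [hΛ, h.hasH2.vel_eq zero_mem_unit]
  have hΛ0 : ∀ i, 0 ≤ Λ i := fun i => norm_nonneg _
  have hevreg : ∀ i, Λ i ≠ 0 → ∀ᶠ n in atTop, IsRegular (Γ n i) := by
    intro i hi
    filter_upwards [(hℓΛ i).eventually_ne hi] with n hn
    exact (hdich n i).resolve_left fun h => hn h.curveLength_eq
  have hsqrt : ∀ i, Λ i = 0 →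
      Tendsto (fun n => Real.sqrt (curveLength (Γ n i) * K)) atTop (𝓝 0) := by
    intro i hi
    have := ((hℓΛ i).mul_const K).sqrt
    rwa [hi, zero_mul, Real.sqrt_zero] at this
  -- The two end tangents are exactly opposite on singular curves and opposite up to √(ℓK) on
  -- regular ones, where ℓ → 0.
  have hopp : ∀ i, Λ i = 0 → T (0, i) = -T (1, i) := by
    intro i hi
    rw [← add_eq_zero_iff_eq_neg]
    refine tendsto_nhds_unique ((hτi (0, i)).add (hτi (1, i))) ?_
    refine squeeze_zero_norm (fun n => ?_) (hsqrt i hi)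
    rcases hdich n i with h | h
    · rw [((hang n).2.1 i trivial h).2, neg_add_cancel, norm_zero]
      exact Real.sqrt_nonneg _
    · rw [(hang n).1 i trivial h, (hang n).1 i trivial h]
      exact (h.almost_straight (hK n i)).2
  have hrot : IsRotated G D univ T :=
    (isClosed_setOf_isRotated G D univ).mem_of_tendsto hτ
      (Eventually.of_forall fun n => (hang n).2.2)
  refine ⟨⟨fun i _ => ?_, fun z w i _ j _ hr => ?_⟩, T, ⟨fun i _ h z => ?_, fun i _ h => ?_, hrot⟩,
    ?_⟩
  · by_cases hi : Λ i = 0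
    · exact .inl (hsing i hi)
    · exact .inr (hreg i hi)
  · refine tendsto_nhds_unique ((hconv i).tendsto_apply (fin_two_mem_unit z))
      (((hconv j).tendsto_apply (fin_two_mem_unit w)).congr fun n => ?_)
    -- Edges with a common vertex are translated by the same vector, so incidences survive.
    have hc : G.component i = G.component j := Quot.sound ⟨z, w, hr⟩
    rw [hfz, hfz, hc, (hnet n).2 z w i trivial j trivial hr]
  · have hi : Λ i ≠ 0 := fun h0 => (hsing i h0).not_isRegular h
    refine tendsto_nhds_unique (hτi (z, i)) ?_
    have h1 : Tendsto (fun n => (-1 : ℝ) ^ (z : ℕ) •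
        ((curveLength (Γ n i))⁻¹ • vel (f n i) ((z : ℕ) : ℝ))) atTop
        (𝓝 ((-1 : ℝ) ^ (z : ℕ) • ((Λ i)⁻¹ • vel (Γlim i) ((z : ℕ) : ℝ)))) :=
      (((hℓΛ i).inv₀ hi).smul ((hconv i).tendsto_vel (fin_two_mem_unit z))).const_smul _
    rw [← hspeed i _ (fin_two_mem_unit z)] at h1
    refine h1.congr' ?_
    filter_upwards [hevreg i hi] with n hn
    rw [(hang n).1 i trivial hn, outerTangent_eq_of_vel_eq (hfreg n i hn z) (hlen n i hn)]
  · exact ⟨fun z => hT1 z i, hopp i (hsing' i h)⟩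
  · have hSing : ∀ i, i ∈ Sing univ Γlim ↔ Λ i = 0 := fun i =>
      ⟨fun h => hsing' i h.2, fun h => ⟨trivial, hsing i h⟩⟩
    refine Stratified.stratifiedStraight (Stratified.of_forall_pos fun ε hε => ?_)
      (fun i _ z => hT1 z i) (fun i hi => hopp i ((hSing i).1 hi)) (hrot.mono (subset_univ _))
    have e1 : ∀ᶠ n in atTop, ∀ i, ‖τ n (0, i) - T (0, i)‖ < ε / 2 := by
      rw [eventually_all]
      intro i
      have := ((hτi (0, i)).sub_const (T (0, i))).norm
      rw [sub_self, norm_zero] at this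
      exact this.eventually (gt_mem_nhds (half_pos hε))
    have e2 : ∀ᶠ n in atTop, ∀ i, Λ i = 0 → Real.sqrt (curveLength (Γ n i) * K) < ε / 2 := by
      rw [eventually_all]
      intro i
      by_cases hi : Λ i = 0
      · filter_upwards [(hsqrt i hi).eventually (gt_mem_nhds (half_pos hε))] with n hn _ using hn
      · simp [hi]
    have e3 : ∀ᶠ n in atTop, ∀ i, Λ i ≠ 0 → IsRegular (Γ n i) := by
      rw [eventually_all]
      intro i
      by_cases hi : Λ i = 0
      · simp [hi]
      · filter_upwards [hevreg i hi] with n hn _ using hn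
    obtain ⟨n, h1, h2, h3⟩ := (e1.and (e2.and e3)).exists
    classical
    -- `Γ n` itself, restricted to the edges collapsing in the limit, is the first stratum: its
    -- chords are the displacements, and their directions are ε-close to `T`.
    refine .step (fun i => curveLength (Γ n i))
      (fun i => if IsSingular (Γ n i) then τ n (0, i) else
        (curveLength (Γ n i))⁻¹ • (Γ n i 1 - Γ n i 0)) (fun i _ => curveLength_nonneg _)
      (fun i hi => ?_) ?_ ?_
    · by_cases hs : IsSingular (Γ n i)
      · rw [if_pos hs]
        linarith [h1 i]
      · have hr := (hdich n i).resolve_left hs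
        rw [if_neg hs]
        have h4 := (hr.almost_straight (hK n i)).1
        rw [← (hang n).1 i trivial hr] at h4
        refine (norm_sub_le_norm_sub_add_norm_sub _ (τ n (0, i)) _).trans ?_
        linarith [h1 i, h2 i ((hSing i).1 hi)]
    · refine ⟨fun e => Γ n e.2 ((e.1 : ℕ) : ℝ),
        fun z w i _ j _ hr => (hnet n).2 z w i trivial j trivial hr, fun i _ => ?_⟩
      simp only [Fin.val_one, Fin.val_zero, Nat.cast_one, Nat.cast_zero]
      by_cases hs : IsSingular (Γ n i)
      · rw [if_pos hs, hs.curveLength_eq, zero_smul, hs 1 one_mem_unit, sub_self]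
      · rw [if_neg hs, smul_inv_smul₀ (hlen n i ((hdich n i).resolve_left hs)).ne']
    -- Every singular edge of `Γ n` collapses in the limit, because edges with regular limit are
    -- already regular for this n.
    · have he : {i ∈ Sing univ Γlim | curveLength (Γ n i) = 0} = Sing univ (Γ n) := by
        ext i
        constructor
        · rintro ⟨-, h0⟩
          exact ⟨trivial, (hdich n i).resolve_right fun h => (hlen n i h).ne' h0⟩
        · rintro ⟨-, hs⟩
          refine ⟨(hSing i).2 ?_, hs.curveLength_eq⟩
          by_contra hi
          exact hs.not_isRegular (h3 i hi)
      rw [he]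
      exact (hss n).stratified.mono fun i _ => by linarith [h1 i]

/-- Successive extraction over finitely many indices; stability under subsequences preserves the
properties already obtained. -/
lemma exists_common_subseq {ι : Type*} [Finite ι] (Q : ι → (ℕ → ℕ) → Prop)
    (hex : ∀ i (k : ℕ → ℕ), StrictMono k → ∃ j, StrictMono j ∧ Q i (k ∘ j))
    (hcomp : ∀ i (k j : ℕ → ℕ), StrictMono j → Q i k → Q i (k ∘ j)) :
    ∃ k, StrictMono k ∧ ∀ i, Q i k := by
  classical
  have := Fintype.ofFinite ι
  have key : ∀ s : Finset ι, ∃ k, StrictMono k ∧ ∀ i ∈ s, Q i k := by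
    intro s
    induction s using Finset.induction_on with
    | empty => exact ⟨id, strictMono_id, by simp⟩
    | insert a s _ ih =>
      obtain ⟨k, hk, hQ⟩ := ih
      obtain ⟨j, hj, hQj⟩ := hex a k hk
      refine ⟨k ∘ j, hk.comp hj, fun i hi => ?_⟩
      rcases Finset.mem_insert.1 hi with rfl | hi
      · exact hQj
      · exact hcomp i k j hj (hQ i hi)
  obtain ⟨k, hk, hQ⟩ := key Finset.univ
  exact ⟨k, hk, fun i => hQ i (Finset.mem_univ i)⟩

lemma vel_add_const {F : Type*} [NormedAddCommGroup F] [NormedSpace ℝ F] (γ : ℝ → F) (c : F) :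
    vel (fun t => γ t + c) = vel γ := by
  ext t
  exact derivWithin_add_const c

lemma IsH2.add_const {F : Type*} [NormedAddCommGroup F] [NormedSpace ℝ F] {γ : ℝ → F}
    (h : IsH2 γ) (c : F) : IsH2 (fun t => γ t + c) := by
  refine ⟨h.1.add_const c, ?_, ?_⟩
  · rw [acc, vel_add_const]; exact h.2.1
  · rw [acc, vel_add_const]; exact h.2.2

/-- Edges of the same component of a network of bounded length have bounded distance. -/
lemma exists_bound_of_component_eq {G : NGraph N} {Γ : ℕ → Fin N → ℝ → Eucl d}
    (hnet : ∀ n, IsNetwork G univ (Γ n)) {L : ℝ} (hL : ∀ n i, curveLength (Γ n i) ≤ L)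
    {i j : Fin N} (hij : G.component i = G.component j) :
    ∃ m : ℝ, ∀ n, ‖Γ n i 0 - Γ n j 0‖ ≤ m := by
  have hedge : ∀ n i (z : Fin 2), ‖Γ n i (z : ℕ) - Γ n i 0‖ ≤ L := by
    intro n i z
    have h := (norm_chord_le ((hnet n).1 i trivial)).trans (hL n i)
    fin_cases z
    · simpa using (norm_nonneg _).trans h
    · simpa using h
  induction Quot.eqvGen_exact hij with
  | rel i j h =>
    obtain ⟨z, w, hr⟩ := h
    refine ⟨L + L, fun n => ?_⟩
    have e : Γ n i 0 - Γ n j 0 =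
        -(Γ n i (z : ℕ) - Γ n i 0) + (Γ n j (w : ℕ) - Γ n j 0) := by
      rw [(hnet n).2 z w i trivial j trivial hr]; abel
    rw [e]
    refine (norm_add_le _ _).trans (add_le_add ?_ (hedge n j w))
    rw [norm_neg]
    exact hedge n i z
  | refl i => exact ⟨0, fun n => by simp⟩
  | symm i j h ih =>
    obtain ⟨m, hm⟩ := ih (Quot.eqvGen_sound h)
    exact ⟨m, fun n => by rw [norm_sub_rev]; exact hm n⟩
  | trans i j k h1 h2 ih1 ih2 =>
    obtain ⟨m, hm⟩ := ih1 (Quot.eqvGen_sound h1)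
    obtain ⟨m', hm'⟩ := ih2 (Quot.eqvGen_sound h2)
    exact ⟨m + m', fun n => (norm_sub_le_norm_sub_add_norm_sub _ _ _).trans
      (add_le_add (hm n) (hm' n))⟩

lemma energy_bounds {α β : ℝ} (hα : 0 < α) (hβ : 0 < β) {Γ : Fin N → ℝ → Eucl d} {E : ℝ}
    (hE : energy α β Γ ≤ E) (i : Fin N) :
    ∫ t in (0 : ℝ)..1, ‖curvature (Γ i) t‖ ^ 2 * ‖vel (Γ i) t‖ ≤ E / α ∧
      curveLength (Γ i) ≤ E / β := by
  have h1 := fun i => mul_nonneg hα.le (bending_nonneg (Γ i))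
  have h2 := fun i => mul_nonneg hβ.le (curveLength_nonneg (Γ i))
  have h3 := (Finset.single_le_sum (fun i _ => add_nonneg (h1 i) (h2 i)) (Finset.mem_univ i)).trans
    hE
  constructor
  · rw [le_div_iff₀ hα]; linarith [h2 i]
  · rw [le_div_iff₀ hβ]; linarith [h1 i]

/-- Compactness of degenerate networks with uniformly bounded energy. -/
theorem CDeg.exists_subseq {G : NGraph N} {D : Ends N → Metric.sphere (0 : Eucl d) 1}
    {α β : ℝ} (hα : 0 < α) (hβ : 0 < β) {Γ : ℕ → Fin N → ℝ → Eucl d} {E : ℝ}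
    (hE : ∀ n, energy α β (Γ n) ≤ E) (hΓ : ∀ n, Γ n ∈ CDeg G D) :
    ∃ k : ℕ → ℕ, StrictMono k ∧ ∃ Γlim ∈ CDeg G D,
      ConvergesUpToTranslation G (fun n => Γ (k n)) Γlim := by
  choose hnet τ hang hss using hΓ
  set K := E / α
  set L := E / β
  have hK := fun n i => (energy_bounds hα hβ (hE n) i).1
  have hL := fun n i => (energy_bounds hα hβ (hE n) i).2
  choose Γ' hrep hH2 hspeed hreg hacc using fun n i => exists_constantSpeed ((hnet n).1 i trivial)
  have hroot : ∀ c : G.Component, G.component (Quot.out c) = c := fun c => Quot.out_eq c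
  -- The starting point of one chosen edge per component is moved to the origin; the length bound
  -- controls the other edges of the component.
  set v : ℕ → G.Component → Eucl d := fun n c => -Γ n (Quot.out c) 0 with hv
  set f : ℕ → Fin N → ℝ → Eucl d := fun n i t => Γ' n i t + v n (G.component i) with hf
  have hvel : ∀ n i, vel (f n i) = vel (Γ' n i) := fun n i => vel_add_const _ _
  have hfacc : ∀ n i, acc (f n i) = acc (Γ' n i) := fun n i => by rw [acc, hvel]; rfl
  have hfH : ∀ n i, IsH2 (f n i) := fun n i => (hH2 n i).add_const _
  have hconv : ∀ i (k : ℕ → ℕ), ∃ j, StrictMono j ∧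
      ∃ g, CurveConverges (fun n => f ((k ∘ j) n) i) g := by
    intro i k
    obtain ⟨m, hm⟩ := exists_bound_of_component_eq hnet hL (hroot (G.component i)).symm
    set M := max m (max L (L ^ 3 * K)) with hM
    refine exists_curveConverges_subseq (f := fun n => f (k n) i) (fun n => hfH (k n) i) (M := M)
      (fun n => ?_) (fun n => ?_) (fun n => ?_)
    · refine le_trans ?_ (le_max_left _ _)
      simp only [hf, hv, (hrep (k n) i).apply_zero, ← sub_eq_add_neg]
      exact hm (k n)
    · refine le_trans ?_ ((le_max_left _ _).trans (le_max_right _ _))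
      rw [hvel, hspeed _ _ 0 zero_mem_unit]
      exact hL (k n) i
    · refine le_trans ?_ ((le_max_right _ _).trans (le_max_right _ _))
      rw [hfacc, hacc]
      have h1 := curveLength_nonneg (Γ (k n) i)
      have h2 := bending_nonneg (Γ (k n) i)
      have h3 := hL (k n) i
      have h4 := hK (k n) i
      have h5 : 0 ≤ L := h1.trans h3
      gcongr
  obtain ⟨k₁, hk₁, hQ⟩ := exists_common_subseq
    (fun i k => ∃ g, CurveConverges (fun n => f (k n) i) g) (fun i k _ => hconv i k)
    (fun i k j hj ⟨g, hg⟩ => ⟨g, hg.comp hj⟩)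
  choose Γlim hlim using hQ
  have hτb : ∀ n, τ (k₁ n) ∈ Metric.closedBall (0 : Ends N → Eucl d) 1 := by
    intro n
    rw [mem_closedBall_zero_iff, pi_norm_le_iff_of_nonneg zero_le_one]
    rintro ⟨z, i⟩
    rcases (hnet (k₁ n)).1 i trivial with h | h
    · exact (((hang (k₁ n)).2.1 i trivial h).1 z).le
    · rw [(hang (k₁ n)).1 i trivial h z, norm_outerTangent h]
  obtain ⟨T, -, k₂, hk₂, hT⟩ := tendsto_subseq_of_bounded Metric.isBounded_closedBall hτb
  have hlim' : ∀ i, CurveConverges (fun n => f (k₁ (k₂ n)) i) (Γlim i) := fun i =>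
    (hlim i).comp hk₂
  refine ⟨k₁ ∘ k₂, hk₁.comp hk₂, Γlim, ?_, fun n => v (k₁ (k₂ n)), fun n => Γ' (k₁ (k₂ n)),
    fun n i => hrep _ i, hlim'⟩
  refine mem_CDeg_of_curveConverges (Γ := fun n => Γ (k₁ (k₂ n))) (τ := fun n => τ (k₁ (k₂ n)))
    (v := fun n => v (k₁ (k₂ n))) (K := K) (fun n => hnet _) (fun n => hang _) (fun n => hss _)
    (fun n i => hK _ i) hT (fun n i z => ?_) (fun n i t ht => ?_) (fun n i hr z => ?_) hlim'
  · simp only [hf, (hrep _ i).apply_fin_two z]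
  · rw [hvel]; exact hspeed _ i t ht
  · rw [hvel]; exact hreg _ i hr z

lemma CReg_subset_CDeg (G : NGraph N) (D : Ends N → Metric.sphere (0 : Eucl d) 1) :
    CReg G D ⊆ CDeg G D := by
  rintro Γ ⟨hnet, hsing, hrot⟩
  refine ⟨hnet, fun e => outerTangent (Γ e.2) e.1, ⟨fun _ _ _ _ => rfl, fun i _ h => ?_, hrot⟩, ?_⟩
  · have : i ∈ Sing univ Γ := ⟨trivial, h⟩
    rw [hsing] at this
    exact absurd this (notMem_empty i)
  · rw [hsing]
    exact ⟨0, fun _ => ∅, fun _ _ _ => 0, rfl, rfl, fun j hj => absurd hj (Nat.not_lt_zero j)⟩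

/-- Compactness of degenerate networks with bounded upper limit of the energies. -/
theorem CDeg.exists_subseq_of_limsup_le {G : NGraph N}
    {D : Ends N → Metric.sphere (0 : Eucl d) 1} {α β : ℝ} (hα : 0 < α) (hβ : 0 < β)
    {Γ : ℕ → Fin N → ℝ → Eucl d} {C : ℝ}
    (hC : limsup (fun n => (energy α β (Γ n) : EReal)) atTop ≤ C) (hΓ : ∀ n, Γ n ∈ CDeg G D) :
    ∃ k : ℕ → ℕ, StrictMono k ∧ ∃ Γlim ∈ CDeg G D,
      ConvergesUpToTranslation G (fun n => Γ (k n)) Γlim := by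
  -- Any real number above `C` bounds a tail of the energies; the finitely many earlier terms are
  -- dropped by shifting the sequence.
  have hlt : limsup (fun n => (energy α β (Γ n) : EReal)) atTop < ((C + 1 : ℝ) : EReal) :=
    hC.trans_lt (EReal.coe_lt_coe_iff.2 (lt_add_one C))
  obtain ⟨n₀, hn₀⟩ := eventually_atTop.1 (eventually_lt_of_limsup_lt hlt)
  obtain ⟨k, hk, Γlim, hmem, hconv⟩ := CDeg.exists_subseq hα hβ (Γ := fun n => Γ (n + n₀))
    (E := C + 1) (fun n => (EReal.coe_lt_coe_iff.1 (hn₀ (n + n₀) (Nat.le_add_left _ _))).le)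
    (fun n => hΓ _)
  exact ⟨fun n => k n + n₀, fun a b hab => Nat.add_lt_add_right (hk hab) n₀, Γlim, hmem, hconv⟩

end Main

end ElasticNetwork

end

theorem mainTheorem2 {N d : ℕ} (hd : 2 ≤ d) (G : ElasticNetwork.NGraph N)
    (D : ElasticNetwork.Ends N → Metric.sphere (0 : ElasticNetwork.Eucl d) 1)
    (α β : ℝ) (hα : 0 < α) (hβ : 0 < β)
    (Γ : ℕ → Fin N → ℝ → ElasticNetwork.Eucl d) (C : ℝ)
    (hC : Filter.limsup (fun n => (ElasticNetwork.energy α β (Γ n) : EReal)) Filter.atTop ≤ C) :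
    ((∀ n, Γ n ∈ ElasticNetwork.CDeg G D) →
      ∃ k : ℕ → ℕ, StrictMono k ∧ ∃ Γlim ∈ ElasticNetwork.CDeg G D,
        ElasticNetwork.ConvergesUpToTranslation G (fun n => Γ (k n)) Γlim) ∧
    ((∀ n, Γ n ∈ ElasticNetwork.CReg G D) →
      ∃ k : ℕ → ℕ, StrictMono k ∧ ∃ Γlim ∈ ElasticNetwork.CDeg G D,
        ElasticNetwork.ConvergesUpToTranslation G (fun n => Γ (k n)) Γlim) :=
  ⟨fun h => ElasticNetwork.CDeg.exists_subseq_of_limsup_le hα hβ hC h,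
    fun h => ElasticNetwork.CDeg.exists_subseq_of_limsup_le hα hβ hC
      fun n => ElasticNetwork.CReg_subset_CDeg G D (h n)⟩
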